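/- **Setting.** Let $D\subseteq\mathbb R^d$ be open and connected with boundary $S=\partial D$ (carrying the surface measure), $T=[t_0,t_f]$ with $t_0<t_f$, and write $\langle\cdot,\cdot\rangle$, $\langle\cdot,\cdot\rangle_S$ for the inner products of $L_2(D)$, $L_2(S)$. The state takes values in $\mathbb R^n$, the distributed control $U_d(t)\in L_2^k(D)$, the boundary control $U_b(t)\in L_2^l(S)$; $U=(U_d,U_b)$ is the stacked control, an element of $L_2^{k+l}(T)$, whose inner product is $\langle U,W\rangle_T=\int_{t_0}^{t_f}\big(\langle U_d,W_d\rangle+\langle U_b,W_b\rangle_S\big)dt$. Consider $$\partial_tX=F(t,X,U_d)\ \text{in }D,\qquad 0=N(t,X,U_b)\ \text{on }S,\qquad X(t_0)=X_0,$$ where $F=\sum_i\partial_i a_i(t,X)+f(t,X,U_d)$ and $N=\sum_i\nu_i a_i(t,X)+g(t,X,U_b)$ ($\nu$ the outer normal; $a_i,f,g$ possibly nonlinear and nonlocal, and possibly depending on $\nabla X$ and on the trace of $X$); on a (possibly empty) measurable part $\Gamma$ of $S$ the condition $X=0$ is imposed instead. Let $H^1$ be the space of fields with square integrable gradient and trace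 that vanish on $\Gamma$ (the $L_2$-closure of the triples (value, gradient, boundary value) of smooth compactly supported functions, cut down to zero trace on $\Gamma$). All equations are understood weakly: solutions lie in $\mathcal W=C(T;L_2^n(D))\cap L_2(T;H^1)$ with time derivative in $L_2(T;(H^1)')$, and for test fields $P\in H^1$ the pair $(F,N)$ acts by $-\sum_i\langle a_i,\partial_iP\rangle+\langle f,P\rangle-\langle g,P\rangle_S$. The cost is $$J(U)=\phi(t_f,X(t_f))+\int_{t_0}^{t_f}L(t,X,U_d,U_b)\,dt ,$$ $X$ being the state with control $U$. **Assumptions.** (1) The PDE is well posed in the sense of Hadamard: for all $X_0$ and all $U\in L_2^{k+l}(T)$ there is a unique weak solution, depending continuously (in $\mathcal W$) on $(X_0,U)$. Let $\bar U\in L_2^{k+l}(T)$ be a nominal control with state $\bar X$. (2) $a,f,g$ are Gateaux differentiable along $(\bar X,\bar U)$ for almost every $t$, with derivatives forming $F_X,F_{U_d},N_X,N_{U_b}$; $L$ and $\phi$ have Gateaux gradients everywhere and second Gateaux derivatives along $(\bar X,\bar U)$. $L$ has no cross terms there: $L_{U_dX},L_{XU_d},L_{U_bX},L_{XU_b},L_{U_dU_b},L_{U_bU_d}$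 vanish. $L_X,L_{U_d},L_{U_b}$ are square integrable over $T$. $L_{U_dU_d}(t),L_{U_bU_b}(t)$ are strongly measurable in $t$, symmetric, and bounded and positive definite uniformly in $t\in T$. (3) The linear variation system with $F_X,N_X$ is well posed: for every initial value in $L_2^n(D)$ and every forcing in $L_2(T;(H^1)')$ a weak solution exists, and its norm in $\mathcal W$ is bounded by a constant times the norms of these data. (4) For the update $\delta U$ below, the first order expansions at $(\bar X,\bar U)$ of $(F,N)$ (in $L_2(T;(H^1)')$), of $\int_T L\,dt$ and of $\phi$ have second order remainders: for state variations $h\in\mathcal W$ and control variations $\gamma\,\delta U$, both small, the remainders are $O((\|h\|_{\mathcal W}+|\gamma|)^2)$, and $L$ is integrable along $(\bar X+h,\bar U+\gamma\,\delta U)$; for $\phi$ the remainder is $O(\|h(t_f)\|^2)$. **STDDP update.** Put $Q_U=(Q_{U_d},Q_{U_b})$ with $$Q_{U_d}=L_{U_d}+F_{U_d}^\top V_X,\quad Q_{U_b}=L_{U_b}-N_{U_b}^\top V_X|_S,\quad Q_{U_dX}=F_{U_d}^\top V_{XX},\quad Q_{U_bX}=-N_{U_b}^\top V_{XX}|_S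 .$$ Here $V_X$, and $V_{XX}$ (symmetric; bounded on $L_2^n(D)$ for each $t$ and acting boundedly on $H^1$ for almost every $t$), are weak solutions of the backward value equations along the nominal trajectory: $$-\tfrac{d}{dt}V_X=L_X+F_X^*V_X-\sum_{c\in\{d,b\}}Q_{U_cX}^\top L_{U_cU_c}^{-1}Q_{U_c},\quad N_X^*V_X=0\text{ on }S,\quad V_X(t_f)=\phi_X,$$ $$-\tfrac{d}{dt}V_{XX}=L_{XX}+F_X^*V_{XX}+[F_X^*V_{XX}]^\top-\sum_{c\in\{d,b\}}Q_{U_cX}^\top L_{U_cU_c}^{-1}Q_{U_cX},\quad N_X^*V_{XX}=0\text{ on }S,\quad V_{XX}(t_f)=\phi_{XX}.$$ The update $\delta U=(\delta U_d,\delta U_b)$ is $$\delta U_d=-L_{U_dU_d}^{-1}\big(Q_{U_d}+Q_{U_dX}\,\delta X\big),\qquad \delta U_b=-L_{U_bU_b}^{-1}\big(Q_{U_b}+Q_{U_bX}\,\delta X\big),$$ where $\delta X$ solves the variation dynamics driven by it: $$\tfrac{d}{dt}\delta X=F_X\delta X+F_{U_d}\delta U_d\ \text{in }D,\qquad 0=N_X\delta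 X+N_{U_b}\delta U_b\ \text{on }S,\qquad \delta X(t_0)=0 .$$ Assume $\delta U,\,Q_U\in L_2^{k+l}(T)$. The control update with step size $\gamma$ is $\bar U\mapsto\bar U+\gamma\,\delta U$, and correspondingly $dU/di=\gamma\,\delta U$ for a continuous iteration index $i$. **Theorem.** There is a bounded operator $M$ on $L_2^{k+l}(T)$, independent of $\gamma$, acting at each time $t$ by an operator $M(t)$ that is symmetric and positive definite for every $t\in T$ (uniformly in $t$), namely $M(t)=L_{UU}(t)^{-1}$ with $L_{UU}=\operatorname{diag}(L_{U_dU_d},L_{U_bU_b})$, such that: 1. for every $\gamma$, with the derivative taken at the current iterate along $dU/di=\gamma\,\delta U$, $$\frac{dJ}{di}=-\gamma\,\langle Q_U,MQ_U\rangle_T+O(\gamma^2)\qquad(\gamma\to0);$$ 2. the change of the cost over one update satisfies $$J(\bar U+\gamma\,\delta U)-J(\bar U)=-\gamma\,\langle Q_U,MQ_U\rangle_T+O(\gamma^2)\qquad(\gamma\to0);$$ 3. consequently, if $Q_U\neq0$ in $L_2^{k+l}(T)$, then $J(\bar U+\gamma\,\delta U)<J(\bar U)$ for all sufficiently small $\gamma>0$.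 -/

import Mathlib

open MeasureTheory Set Filter Topology
open scoped ENNReal InnerProductSpace ContDiff

noncomputable section

namespace STDDP

/-! ### Hilbert spaces over the domain and over its boundary -/

abbrev Euc (m : ℕ) := EuclideanSpace ℝ (Fin m)

/-- `L₂ᵐ(D)`: square integrable `ℝᵐ`-valued functions on the domain `D`. -/
abbrev L2D {d : ℕ} (D : Set (Euc d)) (m : ℕ) := Lp (Euc m) 2 (volume.restrict D)

/-- The surface measure on the boundary `S = ∂D`: the `(d-1)`-dimensional Hausdorff measure,
normalised to agree with Lebesgue measure on hyperplanes. -/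
def surface {d : ℕ} (D : Set (Euc d)) : Measure (Euc d) :=
  (Measure.euclideanHausdorffMeasure (d - 1)).restrict (frontier D)

/-- `L₂ᵐ(S)`: square integrable `ℝᵐ`-valued functions on the boundary `S = ∂D`. -/
abbrev L2S {d : ℕ} (D : Set (Euc d)) (m : ℕ) := Lp (Euc m) 2 (surface D)

/-- The triples (value on `D`, partial derivatives on `D`, value on `S`) of the smooth, compactly
supported functions `φ : ℝᵈ → ℝⁿ`. -/
def smoothFields {d : ℕ} (D : Set (Euc d)) (n : ℕ) :
    Submodule ℝ (L2D D n × (Fin d → L2D D n) × L2S D n) where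
  carrier := {p | ∃ φ : Euc d → Euc n, ContDiff ℝ ∞ φ ∧ HasCompactSupport φ ∧
    p.1 =ᵐ[volume.restrict D] φ ∧
    (∀ i, p.2.1 i =ᵐ[volume.restrict D] fun x => fderiv ℝ φ x (EuclideanSpace.single i 1)) ∧
    p.2.2 =ᵐ[surface D] φ}
  zero_mem' := by
    refine ⟨0, contDiff_const, HasCompactSupport.zero, Lp.coeFn_zero _ _ _, fun i => ?_,
      Lp.coeFn_zero _ _ _⟩
    filter_upwards [Lp.coeFn_zero (Euc n) 2 (volume.restrict D)] with x hx
    simpa using hx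
  add_mem' := by
    rintro p q ⟨φ, hφ, hφc, h1, h2, h3⟩ ⟨ψ, hψ, hψc, k1, k2, k3⟩
    refine ⟨φ + ψ, hφ.add hψ, hφc.add hψc, ?_, fun i => ?_, ?_⟩
    · exact (Lp.coeFn_add p.1 q.1).trans (h1.add k1)
    · refine (Lp.coeFn_add (p.2.1 i) (q.2.1 i)).trans ?_
      filter_upwards [h2 i, k2 i] with x hx kx
      rw [Pi.add_apply, hx, kx, fderiv_add (hφ.differentiable (by simp) x)
        (hψ.differentiable (by simp) x)]
      rfl
    · exact (Lp.coeFn_add p.2.2 q.2.2).trans (h3.add k3)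
  smul_mem' := by
    rintro c p ⟨φ, hφ, hφc, h1, h2, h3⟩
    refine ⟨c • φ, hφ.const_smul c, hφc.smul_left (f := fun _ => c), ?_, fun i => ?_, ?_⟩
    · exact (Lp.coeFn_smul c p.1).trans (h1.const_smul c)
    · refine (Lp.coeFn_smul c (p.2.1 i)).trans ?_
      filter_upwards [h2 i] with x hx
      rw [Pi.smul_apply, hx, fderiv_const_smul (hφ.differentiable (by simp) x)]
      rfl
    · exact (Lp.coeFn_smul c p.2.2).trans (h3.const_smul c)

/-- The triples whose boundary value vanishes almost everywhere on `Γ`. -/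
def zeroOn {d : ℕ} (D Γ : Set (Euc d)) (n : ℕ) :
    Submodule ℝ (L2D D n × (Fin d → L2D D n) × L2S D n) where
  carrier := {p | p.2.2 =ᵐ[(surface D).restrict Γ] (0 : Euc d → Euc n)}
  zero_mem' := ae_restrict_of_ae (Lp.coeFn_zero (Euc n) 2 (surface D))
  add_mem' := by
    intro p q hp hq
    have h := ae_restrict_of_ae (s := Γ) (Lp.coeFn_add p.2.2 q.2.2)
    change (p + q).2.2 =ᵐ[(surface D).restrict Γ] (0 : Euc d → Euc n)
    filter_upwards [h, hp, hq] with x hx hpx hqx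
    simpa [hpx, hqx] using hx
  smul_mem' := by
    intro c p hp
    have h := ae_restrict_of_ae (s := Γ) (Lp.coeFn_smul c p.2.2)
    change (c • p).2.2 =ᵐ[(surface D).restrict Γ] (0 : Euc d → Euc n)
    filter_upwards [h, hp] with x hx hpx
    simpa [hpx] using hx

/-- The Sobolev space `H¹(D; ℝⁿ)` of fields with gradient and trace, with vanishing trace on the
(possibly empty) part `Γ` of the boundary. A field is stored as the triple (value, weak partial
derivatives, trace); the space is the closure in `L₂` of the triples of smooth functions (for a
Lipschitz domain, value determines gradient and trace and this is the usual `H¹`),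
cut down to the triples with zero trace on `Γ`. -/
def fieldSpace {d : ℕ} (D Γ : Set (Euc d)) (n : ℕ) :
    Submodule ℝ (L2D D n × (Fin d → L2D D n) × L2S D n) :=
  (smoothFields D n).topologicalClosure ⊓ zeroOn D Γ n

section Fields

variable {d : ℕ} {D Γ : Set (Euc d)} {n : ℕ}

/-- The value of a field, as an element of `L₂ⁿ(D)`. -/
def val : fieldSpace D Γ n →L[ℝ] L2D D n :=
  (ContinuousLinearMap.fst ℝ _ _).comp (fieldSpace D Γ n).subtypeL

/-- The `i`-th weak partial derivative of a field. -/
def grad (i : Fin d) : fieldSpace D Γ n →L[ℝ] L2D D n :=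
  (ContinuousLinearMap.proj i).comp ((ContinuousLinearMap.fst ℝ _ _).comp
    ((ContinuousLinearMap.snd ℝ _ _).comp (fieldSpace D Γ n).subtypeL))

/-- The trace of a field on the boundary, as an element of `L₂ⁿ(S)`. -/
def tr : fieldSpace D Γ n →L[ℝ] L2S D n :=
  (ContinuousLinearMap.snd ℝ _ _).comp
    ((ContinuousLinearMap.snd ℝ _ _).comp (fieldSpace D Γ n).subtypeL)

/-- The weak form of the pair `(F, N)` with `F = ∑ᵢ ∂ᵢ aᵢ + f` in `D` and `N = ∑ᵢ νᵢ aᵢ + g` on `S`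
(`ν` the outer normal): if `N = 0`, then Gauss' theorem gives, for every test field `P`,
`⟨F, P⟩ = - ∑ᵢ ⟨aᵢ, ∂ᵢP⟩ + ⟨f, P⟩ - ⟨g, P⟩_S`. -/
def weakForm (a : Fin d → L2D D n) (f : L2D D n) (g : L2S D n) :
    fieldSpace D Γ n →L[ℝ] ℝ :=
  -(∑ i, (innerSL ℝ (a i)).comp (grad i)) + (innerSL ℝ f).comp val - (innerSL ℝ g).comp tr

/-- The weak form of the adjoint pair `(F_X^*, N_X^*)` applied to `q`, where `(F_X, N_X)` is the
linear pair with coefficients `aX, fX, gX`: by Green's formula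
`⟨q, F_X P⟩ - ⟨P, F_X^* q⟩ = ⟨q, N_X P⟩_S - ⟨P, N_X^* q⟩_S`, the functional
`P ↦ ⟨P, F_X^* q⟩ - ⟨P, N_X^* q⟩_S` is the weak form of `(F_X, N_X)` applied to `P`, tested
with `q`. -/
def adjointForm (aX : fieldSpace D Γ n →L[ℝ] (Fin d → L2D D n))
    (fX : fieldSpace D Γ n →L[ℝ] L2D D n) (gX : fieldSpace D Γ n →L[ℝ] L2S D n)
    (q : fieldSpace D Γ n) : fieldSpace D Γ n →L[ℝ] ℝ :=
  -(∑ i, (innerSL ℝ (grad i q)).comp ((ContinuousLinearMap.proj i).comp aX))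
    + (innerSL ℝ (val q)).comp fX - (innerSL ℝ (tr q)).comp gX

end Fields

/-! ### Trajectories and weak time derivatives -/

/-- Lebesgue measure on the time domain `T = [t₀, t_f]`. -/
def timeMeasure (t₀ tf : ℝ) : Measure ℝ := volume.restrict (Icc t₀ tf)

/-- A state trajectory is recorded by its value in `L₂ⁿ(D)` at every time, together with the
corresponding Sobolev field, which is meaningful at almost every time. -/
abbrev Path {d : ℕ} (D Γ : Set (Euc d)) (n : ℕ) := ℝ → L2D D n × fieldSpace D Γ n

section Paths

variable {d : ℕ} {D Γ : Set (Euc d)} {n : ℕ}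

/-- State trajectories: `C(T; L₂ⁿ(D)) ∩ L₂(T; H¹)`. -/
structure IsPath (t₀ tf : ℝ) (x : Path D Γ n) : Prop where
  cont : ContinuousOn (fun t => (x t).1) (Icc t₀ tf)
  memLp : MemLp (fun t => (x t).2) 2 (timeMeasure t₀ tf)
  val_eq : ∀ᵐ t ∂timeMeasure t₀ tf, val (x t).2 = (x t).1

/-- The norm of `C(T; L₂ⁿ(D)) ∩ L₂(T; H¹)`. -/
def pathNorm (t₀ tf : ℝ) (x : Path D Γ n) : ℝ :=
  sSup ((fun t => ‖(x t).1‖) '' Icc t₀ tf)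
    + (eLpNorm (fun t => (x t).2) 2 (timeMeasure t₀ tf)).toReal

/-- `dx/dt = ℓ` weakly on `T`, with `ℓ` in `L₂(T; (H¹)')`. -/
structure HasWeakTimeDeriv (t₀ tf : ℝ) (x : Path D Γ n)
    (ℓ : ℝ → (fieldSpace D Γ n →L[ℝ] ℝ)) : Prop where
  isPath : IsPath t₀ tf x
  memLp : MemLp ℓ 2 (timeMeasure t₀ tf)
  eq : ∀ P : fieldSpace D Γ n, ∀ t ∈ Icc t₀ tf,
    ⟪(x t).1, val P⟫_ℝ = ⟪(x t₀).1, val P⟫_ℝ + ∫ s in t₀..t, ℓ s P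

end Paths

/-! ### The controlled PDE and the cost -/

/-- A controlled PDE `∂ₜX = F(t, X, U_d)` in `D`, `0 = N(t, X, U_b)` on `S`, with
`F = ∑ᵢ ∂ᵢ aᵢ(t, X) + f(t, X, U_d)` and `N = ∑ᵢ νᵢ aᵢ(t, X) + g(t, X, U_b)`. The maps
`a = flux`, `f = source`, `g = bdry` may be nonlinear and nonlocal, and may depend on `∇X` and on
the trace of `X`. On `Γ` the homogeneous Dirichlet condition is imposed instead. -/
structure System {d : ℕ} (D Γ : Set (Euc d)) (n k l : ℕ) where
  flux : ℝ → fieldSpace D Γ n → (Fin d → L2D D n)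
  source : ℝ → fieldSpace D Γ n → L2D D k → L2D D n
  bdry : ℝ → fieldSpace D Γ n → L2S D l → L2S D n

/-- Running cost `L(t, X, U_d, U_b)` and terminal cost `φ(t, X)`. -/
structure Cost {d : ℕ} (D : Set (Euc d)) (n k l : ℕ) where
  running : ℝ → L2D D n → L2D D k → L2S D l → ℝ
  terminal : ℝ → L2D D n → ℝ

section Problem

variable {d : ℕ} {D Γ : Set (Euc d)} {n k l : ℕ}

/-- The weak form of the dynamics and boundary condition at time `t`. -/
def System.rhs (sys : System D Γ n k l) (t : ℝ) (X : fieldSpace D Γ n) (ud : L2D D k)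
    (ub : L2S D l) : fieldSpace D Γ n →L[ℝ] ℝ :=
  weakForm (sys.flux t X) (sys.source t X ud) (sys.bdry t X ub)

/-- `x` is a weak solution of the PDE with controls `ud`, `ub` and initial condition `X₀`. -/
def System.IsSolution (sys : System D Γ n k l) (t₀ tf : ℝ) (X₀ : L2D D n) (ud : ℝ → L2D D k)
    (ub : ℝ → L2S D l) (x : Path D Γ n) : Prop :=
  HasWeakTimeDeriv t₀ tf x (fun t => sys.rhs t (x t).2 (ud t) (ub t)) ∧ (x t₀).1 = X₀

/-- Well-posedness in the sense of Hadamard: existence, uniqueness and continuous dependence of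
the weak solution on the initial condition and on the controls. -/
structure System.WellPosed (sys : System D Γ n k l) (t₀ tf : ℝ) : Prop where
  existence : ∀ (X₀ : L2D D n) (ud : ℝ → L2D D k) (ub : ℝ → L2S D l),
    MemLp ud 2 (timeMeasure t₀ tf) → MemLp ub 2 (timeMeasure t₀ tf) →
    ∃ x : Path D Γ n, sys.IsSolution t₀ tf X₀ ud ub x
  uniqueness : ∀ (X₀ : L2D D n) (ud : ℝ → L2D D k) (ub : ℝ → L2S D l),
    MemLp ud 2 (timeMeasure t₀ tf) → MemLp ub 2 (timeMeasure t₀ tf) →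
    ∀ x y : Path D Γ n, sys.IsSolution t₀ tf X₀ ud ub x → sys.IsSolution t₀ tf X₀ ud ub y →
      (∀ t ∈ Icc t₀ tf, (x t).1 = (y t).1) ∧ ∀ᵐ t ∂timeMeasure t₀ tf, (x t).2 = (y t).2
  stability : ∀ (X₀ : L2D D n) (ud : ℝ → L2D D k) (ub : ℝ → L2S D l) (x : Path D Γ n),
    MemLp ud 2 (timeMeasure t₀ tf) → MemLp ub 2 (timeMeasure t₀ tf) →
    sys.IsSolution t₀ tf X₀ ud ub x →
    ∀ ε > 0, ∃ δ > 0, ∀ (X₀' : L2D D n) (ud' : ℝ → L2D D k) (ub' : ℝ → L2S D l) (x' : Path D Γ n),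
      MemLp ud' 2 (timeMeasure t₀ tf) → MemLp ub' 2 (timeMeasure t₀ tf) →
      sys.IsSolution t₀ tf X₀' ud' ub' x' →
      ‖X₀' - X₀‖ < δ →
      eLpNorm (ud' - ud) 2 (timeMeasure t₀ tf) < ENNReal.ofReal δ →
      eLpNorm (ub' - ub) 2 (timeMeasure t₀ tf) < ENNReal.ofReal δ →
      pathNorm t₀ tf (x' - x) < ε

/-- The cost `J = φ(t_f, X(t_f)) + ∫ L(t, X(t), U_d(t), U_b(t)) dt`. -/
def Cost.total (C : Cost D n k l) (t₀ tf : ℝ) (x : Path D Γ n) (ud : ℝ → L2D D k)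
    (ub : ℝ → L2S D l) : ℝ :=
  C.terminal tf (x tf).1 + ∫ t in t₀..tf, C.running t (x t).1 (ud t) (ub t)

end Problem

/-! ### Expansion along a nominal trajectory -/

/-- The derivatives along a nominal trajectory, as functions of time: the linearised dynamics
`F_X = ∑ᵢ ∂ᵢ aXᵢ + fX`, `F_{U_d} = FU` and boundary operator `N_X = ∑ᵢ νᵢ aXᵢ + gX`, `N_{U_b} = NU`,
and the first and second derivatives of the running and terminal costs. There are no cross terms,
so only the diagonal blocks of the second derivative of `L` are recorded. -/
structure Derivs {d : ℕ} (D Γ : Set (Euc d)) (n k l : ℕ) where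
  aX : ℝ → fieldSpace D Γ n →L[ℝ] (Fin d → L2D D n)
  fX : ℝ → fieldSpace D Γ n →L[ℝ] L2D D n
  gX : ℝ → fieldSpace D Γ n →L[ℝ] L2S D n
  FU : ℝ → L2D D k →L[ℝ] L2D D n
  NU : ℝ → L2S D l →L[ℝ] L2S D n
  LX : ℝ → L2D D n
  LUd : ℝ → L2D D k
  LUb : ℝ → L2S D l
  LXX : ℝ → L2D D n →L[ℝ] L2D D n
  LUdUd : ℝ → L2D D k →L[ℝ] L2D D k
  LUbUb : ℝ → L2S D l →L[ℝ] L2S D l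
  φX : L2D D n
  φXX : L2D D n →L[ℝ] L2D D n

section Expansion

variable {d : ℕ} {D Γ : Set (Euc d)} {n k l : ℕ}

/-- `A` consists of the Gateaux derivatives of the dynamics and of the boundary operator at the
nominal trajectory `(x, ud, ub)`. -/
def Derivs.OfSystem (A : Derivs D Γ n k l) (sys : System D Γ n k l) (t₀ tf : ℝ) (x : Path D Γ n)
    (ud : ℝ → L2D D k) (ub : ℝ → L2S D l) : Prop :=
  ∀ᵐ t ∂timeMeasure t₀ tf, ∀ (h : fieldSpace D Γ n) (v : L2D D k) (w : L2S D l),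
    HasDerivAt (fun s : ℝ => sys.flux t ((x t).2 + s • h)) (A.aX t h) 0 ∧
    HasDerivAt (fun s : ℝ => sys.source t ((x t).2 + s • h) (ud t + s • v))
      (A.fX t h + A.FU t v) 0 ∧
    HasDerivAt (fun s : ℝ => sys.bdry t ((x t).2 + s • h) (ub t + s • w))
      (A.gX t h + A.NU t w) 0

/-- `A` consists of the Gateaux derivatives of the costs at the nominal trajectory `(x, ud, ub)`:
`L` and `φ` have Gateaux gradients everywhere, and these are Gateaux differentiable at the
nominal point with the recorded second derivatives. The cross derivatives
`L_{U_d X}, L_{U_b X}, L_{X U_d}, L_{X U_b}, L_{U_d U_b}, L_{U_b U_d}` vanish there. -/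
def Derivs.OfCost (A : Derivs D Γ n k l) (C : Cost D n k l) (t₀ tf : ℝ) (x : Path D Γ n)
    (ud : ℝ → L2D D k) (ub : ℝ → L2S D l) : Prop :=
  (∀ t ∈ Icc t₀ tf, ∃ (GX : L2D D n → L2D D k → L2S D l → L2D D n)
    (Gd : L2D D n → L2D D k → L2S D l → L2D D k) (Gb : L2D D n → L2D D k → L2S D l → L2S D l),
    (∀ (X : L2D D n) (u : L2D D k) (b : L2S D l) (h : L2D D n) (v : L2D D k) (w : L2S D l),
      HasDerivAt (fun s : ℝ => C.running t (X + s • h) (u + s • v) (b + s • w))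
        (⟪GX X u b, h⟫_ℝ + ⟪Gd X u b, v⟫_ℝ + ⟪Gb X u b, w⟫_ℝ) 0) ∧
    A.LX t = GX (x t).1 (ud t) (ub t) ∧
    A.LUd t = Gd (x t).1 (ud t) (ub t) ∧
    A.LUb t = Gb (x t).1 (ud t) (ub t) ∧
    ∀ (h : L2D D n) (v : L2D D k) (w : L2S D l),
      HasDerivAt (fun s : ℝ => GX ((x t).1 + s • h) (ud t + s • v) (ub t + s • w))
        (A.LXX t h) 0 ∧
      HasDerivAt (fun s : ℝ => Gd ((x t).1 + s • h) (ud t + s • v) (ub t + s • w))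
        (A.LUdUd t v) 0 ∧
      HasDerivAt (fun s : ℝ => Gb ((x t).1 + s • h) (ud t + s • v) (ub t + s • w))
        (A.LUbUb t w) 0) ∧
  ∃ Gφ : L2D D n → L2D D n,
    (∀ X h : L2D D n, HasDerivAt (fun s : ℝ => C.terminal tf (X + s • h)) ⟪Gφ X, h⟫_ℝ 0) ∧
    A.φX = Gφ (x tf).1 ∧
    ∀ h : L2D D n, HasDerivAt (fun s : ℝ => Gφ ((x tf).1 + s • h)) (A.φXX h) 0

/-- The expansion of the dynamics and of the boundary operator around the nominal trajectory has a
remainder of second order, for state variations `h` and control variations `γ (vd, vb)`: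
the remainder is `O((‖h‖ + |γ|)²)` in `L₂(T; (H¹)')`. -/
def Derivs.SystemExpansion (A : Derivs D Γ n k l) (sys : System D Γ n k l) (t₀ tf : ℝ)
    (x : Path D Γ n) (ud vd : ℝ → L2D D k) (ub vb : ℝ → L2S D l) : Prop :=
  ∃ K : ℝ, ∃ r > 0, ∀ (γ : ℝ) (h : Path D Γ n), |γ| ≤ r → IsPath t₀ tf h →
    pathNorm t₀ tf h ≤ r →
    let R : ℝ → (fieldSpace D Γ n →L[ℝ] ℝ) := fun t =>
      sys.rhs t ((x t).2 + (h t).2) (ud t + γ • vd t) (ub t + γ • vb t)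
        - sys.rhs t (x t).2 (ud t) (ub t)
        - weakForm (A.aX t (h t).2) (A.fX t (h t).2 + A.FU t (γ • vd t))
            (A.gX t (h t).2 + A.NU t (γ • vb t))
    MemLp R 2 (timeMeasure t₀ tf) ∧
    eLpNorm R 2 (timeMeasure t₀ tf) ≤ ENNReal.ofReal (K * (pathNorm t₀ tf h + |γ|) ^ 2)

/-- The first order expansions of the running and of the terminal cost around the nominal
trajectory have remainders of second order. -/
def Derivs.CostExpansion (A : Derivs D Γ n k l) (C : Cost D n k l) (t₀ tf : ℝ)
    (x : Path D Γ n) (ud vd : ℝ → L2D D k) (ub vb : ℝ → L2S D l) : Prop :=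
  (∃ K : ℝ, ∃ r > 0, ∀ (γ : ℝ) (h : Path D Γ n), |γ| ≤ r → IsPath t₀ tf h →
    pathNorm t₀ tf h ≤ r →
    IntegrableOn (fun t => C.running t ((x t).1 + (h t).1) (ud t + γ • vd t) (ub t + γ • vb t))
      (Icc t₀ tf) ∧
    |∫ t in t₀..tf, (C.running t ((x t).1 + (h t).1) (ud t + γ • vd t) (ub t + γ • vb t)
        - C.running t (x t).1 (ud t) (ub t)
        - (⟪A.LX t, (h t).1⟫_ℝ + ⟪A.LUd t, γ • vd t⟫_ℝ + ⟪A.LUb t, γ • vb t⟫_ℝ))|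
      ≤ K * (pathNorm t₀ tf h + |γ|) ^ 2) ∧
  ∃ K : ℝ, ∃ r > 0, ∀ h : L2D D n, ‖h‖ ≤ r →
    |C.terminal tf ((x tf).1 + h) - C.terminal tf (x tf).1 - ⟪A.φX, h⟫_ℝ| ≤ K * ‖h‖ ^ 2

/-- The approximate variation system is well posed (it generates a linear evolution system): for
every initial variation and every forcing in `L₂(T; (H¹)')` there is a weak solution,
and weak solutions depend boundedly on these data. -/
structure Derivs.VariationWellPosed (A : Derivs D Γ n k l) (t₀ tf : ℝ) : Prop where
  existence : ∀ (y₀ : L2D D n) (ℓ : ℝ → (fieldSpace D Γ n →L[ℝ] ℝ)),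
    MemLp ℓ 2 (timeMeasure t₀ tf) → ∃ y : Path D Γ n, (y t₀).1 = y₀ ∧
      HasWeakTimeDeriv t₀ tf y (fun t =>
        weakForm (A.aX t (y t).2) (A.fX t (y t).2) (A.gX t (y t).2) + ℓ t)
  stability : ∃ K : ℝ, ∀ (ℓ : ℝ → (fieldSpace D Γ n →L[ℝ] ℝ)) (y : Path D Γ n),
    MemLp ℓ 2 (timeMeasure t₀ tf) →
    HasWeakTimeDeriv t₀ tf y (fun t =>
      weakForm (A.aX t (y t).2) (A.fX t (y t).2) (A.gX t (y t).2) + ℓ t) →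
    pathNorm t₀ tf y ≤ K * (‖(y t₀).1‖ + (eLpNorm ℓ 2 (timeMeasure t₀ tf)).toReal)

/-- The square integrability of the first derivatives of `L` along the nominal trajectory, and the
symmetry and positive definiteness of `L_{U_d U_d}` and `L_{U_b U_b}`. These act as bounded operators
with bounded inverses on the trajectory space, so the bounds are uniform in time. -/
structure Derivs.Regular (A : Derivs D Γ n k l) (t₀ tf : ℝ) : Prop where
  memLp_LX : MemLp A.LX 2 (timeMeasure t₀ tf)
  memLp_LUd : MemLp A.LUd 2 (timeMeasure t₀ tf)
  memLp_LUb : MemLp A.LUb 2 (timeMeasure t₀ tf)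
  meas_d : ∀ u, AEStronglyMeasurable (fun t => A.LUdUd t u) (timeMeasure t₀ tf)
  meas_b : ∀ u, AEStronglyMeasurable (fun t => A.LUbUb t u) (timeMeasure t₀ tf)
  symm_d : ∀ t ∈ Icc t₀ tf, ∀ u v, ⟪A.LUdUd t u, v⟫_ℝ = ⟪u, A.LUdUd t v⟫_ℝ
  symm_b : ∀ t ∈ Icc t₀ tf, ∀ u v, ⟪A.LUbUb t u, v⟫_ℝ = ⟪u, A.LUbUb t v⟫_ℝ
  bdd_d : ∃ K, ∀ t ∈ Icc t₀ tf, ‖A.LUdUd t‖ ≤ K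
  bdd_b : ∃ K, ∀ t ∈ Icc t₀ tf, ‖A.LUbUb t‖ ≤ K
  pos_d : ∃ m > 0, ∀ t ∈ Icc t₀ tf, ∀ u, m * ‖u‖ ^ 2 ≤ ⟪u, A.LUdUd t u⟫_ℝ
  pos_b : ∃ m > 0, ∀ t ∈ Icc t₀ tf, ∀ u, m * ‖u‖ ^ 2 ≤ ⟪u, A.LUbUb t u⟫_ℝ

end Expansion

/-! ### The STDDP sweep -/

/-- `V_XX` as a function of time: an operator on `L₂ⁿ(D)` for every time, together with its action
on Sobolev fields (needed for its boundary values), which is meaningful at almost every time. -/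
abbrev OpPath {d : ℕ} (D Γ : Set (Euc d)) (n : ℕ) :=
  ℝ → (L2D D n →L[ℝ] L2D D n) × (fieldSpace D Γ n →L[ℝ] fieldSpace D Γ n)

section Sweep

variable {d : ℕ} {D Γ : Set (Euc d)} {n k l : ℕ}

/-- `L_{U_d U_d}⁻¹` -/
def Derivs.invd (A : Derivs D Γ n k l) (t : ℝ) : L2D D k →L[ℝ] L2D D k := Ring.inverse (A.LUdUd t)

/-- `L_{U_b U_b}⁻¹` -/
def Derivs.invb (A : Derivs D Γ n k l) (t : ℝ) : L2S D l →L[ℝ] L2S D l := Ring.inverse (A.LUbUb t)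

/-- `Q_{U_d} = L_{U_d} + F_{U_d}ᵀ V_X` -/
def Derivs.Qd (A : Derivs D Γ n k l) (VX : Path D Γ n) (t : ℝ) : L2D D k :=
  A.LUd t + (A.FU t).adjoint (VX t).1

/-- `Q_{U_b} = L_{U_b} - N_{U_b}ᵀ V_X`, with `V_X` evaluated on the boundary -/
def Derivs.Qb (A : Derivs D Γ n k l) (VX : Path D Γ n) (t : ℝ) : L2S D l :=
  A.LUb t - (A.NU t).adjoint (tr (VX t).2)

/-- `Q_{U_d X} = F_{U_d}ᵀ V_XX` (no cross terms) -/
def Derivs.QdX (A : Derivs D Γ n k l) (VXX : OpPath D Γ n) (t : ℝ) :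
    fieldSpace D Γ n →L[ℝ] L2D D k :=
  (A.FU t).adjoint.comp (val.comp (VXX t).2)

/-- `Q_{U_b X} = - N_{U_b}ᵀ V_XX` (no cross terms), with `V_XX` evaluated on the boundary -/
def Derivs.QbX (A : Derivs D Γ n k l) (VXX : OpPath D Γ n) (t : ℝ) :
    fieldSpace D Γ n →L[ℝ] L2S D l :=
  -((A.NU t).adjoint.comp (tr.comp (VXX t).2))

/-- The distributed control update
`δU_d = - L_{U_d U_d}⁻¹ (L_{U_d} + F_{U_d}ᵀ V_X) - L_{U_d U_d}⁻¹ F_{U_d}ᵀ V_XX δX`. -/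
def Derivs.δUd (A : Derivs D Γ n k l) (VX : Path D Γ n) (VXX : OpPath D Γ n) (δX : Path D Γ n)
    (t : ℝ) : L2D D k :=
  -A.invd t (A.Qd VX t) - A.invd t (A.QdX VXX t (δX t).2)

/-- The boundary control update
`δU_b = - L_{U_b U_b}⁻¹ (L_{U_b} - N_{U_b}ᵀ V_X) + L_{U_b U_b}⁻¹ N_{U_b}ᵀ V_XX δX`. -/
def Derivs.δUb (A : Derivs D Γ n k l) (VX : Path D Γ n) (VXX : OpPath D Γ n) (δX : Path D Γ n)
    (t : ℝ) : L2S D l :=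
  -A.invb t (A.Qb VX t) - A.invb t (A.QbX VXX t (δX t).2)

/-- The first order backward equation, in weak form: in `D`
`-dV_X/dt = L_X + F_X^* V_X - Q_{X U_d} L_{U_d U_d}⁻¹ Q_{U_d} - Q_{X U_b} L_{U_b U_b}⁻¹ Q_{U_b}`,
on `S` the boundary condition `N_X^* V_X = 0`, and `V_X(t_f) = φ_X`. -/
def Derivs.BackwardFirst (A : Derivs D Γ n k l) (t₀ tf : ℝ) (VX : Path D Γ n)
    (VXX : OpPath D Γ n) : Prop :=
  HasWeakTimeDeriv t₀ tf VX (fun t =>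
    -((innerSL ℝ (A.LX t)).comp val + adjointForm (A.aX t) (A.fX t) (A.gX t) (VX t).2
      - (innerSL ℝ (A.invd t (A.Qd VX t))).comp (A.QdX VXX t)
      - (innerSL ℝ (A.invb t (A.Qb VX t))).comp (A.QbX VXX t))) ∧
  (VX tf).1 = A.φX

/-- The second order backward equation, in weak form: in `D`
`-dV_XX/dt = L_XX + F_X^* V_XX + [F_X^* V_XX]ᵀ
  - Q_{X U_d} L_{U_d U_d}⁻¹ Q_{U_d X} - Q_{X U_b} L_{U_b U_b}⁻¹ Q_{U_b X}`,
on `S` the boundary condition `N_X^* V_XX = 0`, and `V_XX(t_f) = φ_XX`; `V_XX` is symmetric. -/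
structure Derivs.BackwardSecond (A : Derivs D Γ n k l) (t₀ tf : ℝ) (VXX : OpPath D Γ n) :
    Prop where
  val_eq : ∀ᵐ t ∂timeMeasure t₀ tf, ∀ P, val ((VXX t).2 P) = (VXX t).1 (val P)
  symm : ∀ t ∈ Icc t₀ tf, ∀ P R, ⟪(VXX t).1 P, R⟫_ℝ = ⟪P, (VXX t).1 R⟫_ℝ
  integrable : ∀ P R : fieldSpace D Γ n, IntegrableOn (fun s =>
      ⟪val P, A.LXX s (val R)⟫_ℝ
        + adjointForm (A.aX s) (A.fX s) (A.gX s) ((VXX s).2 R) P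
        + adjointForm (A.aX s) (A.fX s) (A.gX s) ((VXX s).2 P) R
        - ⟪A.QdX VXX s P, A.invd s (A.QdX VXX s R)⟫_ℝ
        - ⟪A.QbX VXX s P, A.invb s (A.QbX VXX s R)⟫_ℝ) (Icc t₀ tf)
  eq : ∀ P R : fieldSpace D Γ n, ∀ t ∈ Icc t₀ tf,
    ⟪val P, (VXX t).1 (val R)⟫_ℝ = ⟪val P, A.φXX (val R)⟫_ℝ + ∫ s in t..tf,
      (⟪val P, A.LXX s (val R)⟫_ℝ
        + adjointForm (A.aX s) (A.fX s) (A.gX s) ((VXX s).2 R) P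
        + adjointForm (A.aX s) (A.fX s) (A.gX s) ((VXX s).2 P) R
        - ⟪A.QdX VXX s P, A.invd s (A.QdX VXX s R)⟫_ℝ
        - ⟪A.QbX VXX s P, A.invb s (A.QbX VXX s R)⟫_ℝ)

/-- The approximate variation dynamics, in weak form, with the STDDP updates as controls:
`dδX/dt = F_X δX + F_{U_d} δU_d` in `D`, `0 = N_X δX + N_{U_b} δU_b` on `S`, `δX(t₀) = 0`. -/
def Derivs.Variation (A : Derivs D Γ n k l) (t₀ tf : ℝ) (VX : Path D Γ n) (VXX : OpPath D Γ n)
    (δX : Path D Γ n) : Prop :=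
  HasWeakTimeDeriv t₀ tf δX (fun t =>
    weakForm (A.aX t (δX t).2) (A.fX t (δX t).2 + A.FU t (A.δUd VX VXX δX t))
      (A.gX t (δX t).2 + A.NU t (A.δUb VX VXX δX t))) ∧
  (δX t₀).1 = 0

end Sweep

/-- `L₂^{k+l}(D̄)`: the Hilbert space of stacked controls `U = (U_d, U_b)`. -/
abbrev Ctrl {d : ℕ} (D : Set (Euc d)) (k l : ℕ) := WithLp 2 (L2D D k × L2S D l)

section Stacked

variable {d : ℕ} {D Γ : Set (Euc d)} {n k l : ℕ}

/-- `Q_U = (Q_{U_d}, Q_{U_b})` -/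
def Derivs.QU (A : Derivs D Γ n k l) (VX : Path D Γ n) (t : ℝ) : Ctrl D k l :=
  WithLp.toLp 2 (A.Qd VX t, A.Qb VX t)

end Stacked

end STDDP

end

/-! The first variation of the cost along `δU` is computed exactly, and everything beyond it is
`O(γ²)`.

Let `h` be the difference between the state for `Ū + γ δU` and the nominal state. Then `h - γ δX`
solves the linear variation system with zero initial value, forced by the remainder of the expansion
of the dynamics. Stability of that system bounds `h - γ δX` by `K (‖h‖ + |γ|)²`. Continuous
dependence makes `h` small, without a rate, and the quadratic inequality then improves this to `‖h‖
= O(γ)`, hence `h - γ δX = O(γ²)` (`trajNorm_linearisation_le`). Inserting this in the expansions of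
`L` and `φ` leaves a cost change that is linear in `γ` up to `O(γ²)` (`cost_expansion`).

The linear coefficient is found by pairing the equation for `V_X` with the one for `δX`
(`first_variation_eq`). The terms in `F_X`, `N_X` cancel against their adjoints, `L_X` cancels
against the cost, and the control terms collect into `⟨Q_U, δU⟩`. Since `V_X` and `δU` contain the
same feedback term in `Q_{UX}`, with opposite effect, only `-⟨Q_U, L_UU⁻¹ Q_U⟩` survives. The
pairing is an integration by parts for trajectories whose time derivatives are merely functionals on
`H¹` (`inner_sub_inner_eq_integral`).

Finally, uniform coercivity and boundedness of `L_UU` make its pointwise inverse a bounded coercive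
operator on `L₂` (`exists_blockDiag_inverse`), so the linear coefficient is strictly negative unless
`Q_U = 0`. The analysis is done for an abstract map `ι : V → H` and abstract gradient, value and
trace; the function spaces over the domain enter only at the end. -/

namespace STDDP

/-! ### Integration by parts in time for weakly differentiable trajectories. -/

section IntegrationByParts

/-- Translation is continuous in `L²(ℝ; E)`. -/
theorem tendsto_eLpNorm_translate_sub {E : Type*} [NormedAddCommGroup E] {f : ℝ → E}
    (hf : MemLp f 2 volume) :
    Tendsto (fun τ : ℝ => eLpNorm (fun t => f (τ + t) - f t) 2 volume) (𝓝 0) (𝓝 0) := by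
  -- Finiteness of the exponent is what makes the translation action on `Lp` continuous.
  have : Fact ((2 : ℝ≥0∞) ≠ ⊤) := ⟨by simp⟩
  have hc : Continuous fun τ : ℝ => DomAddAct.mk τ +ᵥ hf.toLp f :=
    (continuous_vadd.comp (Continuous.prodMk continuous_id continuous_const)).comp
      DomAddAct.mkHomeomorph.continuous
  have h0 : Tendsto (fun τ : ℝ => ‖(DomAddAct.mk τ +ᵥ hf.toLp f) - hf.toLp f‖ₑ) (𝓝 0) (𝓝 0) := by
    have := ((hc.sub continuous_const).enorm (f := fun τ : ℝ =>
      (DomAddAct.mk τ +ᵥ hf.toLp f) - hf.toLp f)).tendsto 0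
    simpa using this
  refine h0.congr fun τ => ?_
  rw [DomAddAct.mk_vadd_toLp, ← MemLp.toLp_sub, Lp.enorm_toLp]
  rfl

theorem lintegral_Ioc_add_eq {E F : Type*} [NormedAddCommGroup E] [NormedAddCommGroup F]
    (ℓ : ℝ → E) (Y : ℝ → F) (δ e t : ℝ) :
    ∫⁻ s in Ioc t (t + δ), ‖ℓ s‖ₑ * ‖Y (t + e) - Y s‖ₑ
      = ∫⁻ r in Ioc 0 δ, ‖ℓ (t + r)‖ₑ * ‖Y (t + e) - Y (t + r)‖ₑ := by
  have hp := (measurePreserving_add_left (volume : Measure ℝ) t)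
  have := hp.setLIntegral_comp_preimage_emb (measurableEmbedding_addLeft t)
    (fun s => ‖ℓ s‖ₑ * ‖Y (t + e) - Y s‖ₑ) (Ioc t (t + δ))
  rw [← this]
  congr 2
  ext r; simp

theorem measurable_enorm_mul_enorm_translate_sub {E F : Type*} [NormedAddCommGroup E]
    [NormedAddCommGroup F] {ℓ : ℝ → E} {Y : ℝ → F} (hℓ : StronglyMeasurable ℓ)
    (hY : StronglyMeasurable Y) (e : ℝ) :
    Measurable fun p : ℝ × ℝ => ‖ℓ (p.1 + p.2)‖ₑ * ‖Y (p.1 + e) - Y (p.1 + p.2)‖ₑ := by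
  have h1 : Measurable fun p : ℝ × ℝ => ‖ℓ (p.1 + p.2)‖ₑ :=
    (hℓ.comp_measurable (g := fun p : ℝ × ℝ => p.1 + p.2) (by fun_prop)).enorm
  have h2 : Measurable fun p : ℝ × ℝ => ‖Y (p.1 + e) - Y (p.1 + p.2)‖ₑ :=
    ((hY.comp_measurable (g := fun p : ℝ × ℝ => p.1 + e) (by fun_prop)).sub
      (hY.comp_measurable (g := fun p : ℝ × ℝ => p.1 + p.2) (by fun_prop))).enorm
  exact h1.mul h2

theorem measurable_lintegral_Ioc_add {E F : Type*} [NormedAddCommGroup E] [NormedAddCommGroup F]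
    {ℓ : ℝ → E} {Y : ℝ → F} (hℓ : StronglyMeasurable ℓ) (hY : StronglyMeasurable Y) (δ e : ℝ) :
    Measurable fun t => ∫⁻ s in Ioc t (t + δ), ‖ℓ s‖ₑ * ‖Y (t + e) - Y s‖ₑ := by
  simp_rw [lintegral_Ioc_add_eq]
  exact (measurable_enorm_mul_enorm_translate_sub hℓ hY e).lintegral_prod_right'

/-- Writing `s = t + r` and exchanging integrals, the inner integral at fixed `r` pairs `ℓ` with `Y`
minus its translate by `e - r`; Cauchy–Schwarz bounds it, and the `r`-window contributes the factor
`δ`. -/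
theorem lintegral_translate_le {E F : Type*} [NormedAddCommGroup E] [NormedAddCommGroup F]
    {ℓ : ℝ → E} {Y : ℝ → F} (hℓ : StronglyMeasurable ℓ) (hY : StronglyMeasurable Y)
    (δ e : ℝ) (B : ℝ≥0∞)
    (hB : ∀ r ∈ Ioc 0 δ, eLpNorm (fun t => Y ((e - r) + t) - Y t) 2 volume ≤ B) :
    ∫⁻ t, ∫⁻ s in Ioc t (t + δ), ‖ℓ s‖ₑ * ‖Y (t + e) - Y s‖ₑ
      ≤ ENNReal.ofReal δ * (eLpNorm ℓ 2 volume * B) := by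
  simp_rw [lintegral_Ioc_add_eq]
  have hm := measurable_enorm_mul_enorm_translate_sub hℓ hY e
  rw [lintegral_lintegral_swap hm.aemeasurable]
  have h2 : ∀ r ∈ Ioc 0 δ, ∫⁻ t, ‖ℓ (t + r)‖ₑ * ‖Y (t + e) - Y (t + r)‖ₑ
      ≤ eLpNorm ℓ 2 volume * B := by
    intro r hr
    have h3 : ∫⁻ t, ‖ℓ (t + r)‖ₑ * ‖Y (t + e) - Y (t + r)‖ₑ
        = ∫⁻ t, ‖ℓ t‖ₑ * ‖Y ((e - r) + t) - Y t‖ₑ := by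
      rw [← lintegral_add_right_eq_self (fun t => ‖ℓ t‖ₑ * ‖Y ((e - r) + t) - Y t‖ₑ) r]
      congr with t
      ring_nf
    rw [h3]
    have hsub : StronglyMeasurable fun t => Y ((e - r) + t) - Y t :=
      (hY.comp_measurable (by fun_prop)).sub hY
    refine (ENNReal.lintegral_mul_le_Lp_mul_Lq volume Real.HolderConjugate.two_two
      hℓ.enorm.aemeasurable hsub.enorm.aemeasurable).trans ?_
    refine mul_le_mul' ?_ (le_trans ?_ (hB r hr))
    · rw [eLpNorm_eq_lintegral_rpow_enorm_toReal (by simp) (by simp)]; simp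
    · rw [eLpNorm_eq_lintegral_rpow_enorm_toReal (by simp) (by simp)]; simp
  calc _ ≤ ∫⁻ r in Ioc 0 δ, eLpNorm ℓ 2 volume * B :=
        setLIntegral_mono' measurableSet_Ioc h2
    _ = _ := by simp [mul_comm]

/-- The bound is `o(δ)`: the window length gives `δ`, and continuity of translation gives `ε`,
because `|e - r| ≤ δ` for `e` and `r` in the window. -/
theorem exists_lintegral_translate_le {E F : Type*} [NormedAddCommGroup E] [NormedAddCommGroup F]
    {ℓ : ℝ → E} {Y : ℝ → F} (hℓ : StronglyMeasurable ℓ) (hY : StronglyMeasurable Y)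
    (hℓ2 : MemLp ℓ 2 volume) (hY2 : MemLp Y 2 volume) {ε : ℝ} (hε : 0 < ε) :
    ∃ δ₀ > 0, ∀ δ ∈ Ioo 0 δ₀, ∀ e ∈ Icc 0 δ,
      ∫⁻ t, ∫⁻ s in Ioc t (t + δ), ‖ℓ s‖ₑ * ‖Y (t + e) - Y s‖ₑ ≤ ENNReal.ofReal (δ * ε) := by
  set N := eLpNorm ℓ 2 volume with hN
  have hNt : N ≠ ⊤ := hℓ2.2.ne
  -- The `+ 1` keeps the quotient meaningful when `N = 0`, and still `N * (ε / (N + 1)) ≤ ε`.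
  have hη : 0 < ENNReal.ofReal (ε / (N.toReal + 1)) := by
    rw [ENNReal.ofReal_pos]; positivity
  have := (tendsto_eLpNorm_translate_sub hY2).eventually (Iic_mem_nhds hη)
  rw [Metric.eventually_nhds_iff] at this
  obtain ⟨δ₀, hδ₀, h⟩ := this
  refine ⟨δ₀, hδ₀, fun δ hδ e he => ?_⟩
  refine (lintegral_translate_le hℓ hY δ e _ (fun r hr => h ?_)).trans ?_
  · rw [Real.dist_eq, sub_zero]
    have := hδ.2; have := he.1; have := he.2; have := hr.1; have := hr.2
    rw [abs_lt]; constructor <;> linarith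
  · rw [ENNReal.ofReal_mul hδ.1.le]
    gcongr
    rw [← hN]
    have hN0 : 0 ≤ N.toReal := ENNReal.toReal_nonneg
    nth_rewrite 1 [← ENNReal.ofReal_toReal hNt]
    rw [← ENNReal.ofReal_mul hN0]
    apply ENNReal.ofReal_le_ofReal
    rw [mul_div_assoc', div_le_iff₀ (by positivity)]
    nlinarith

/-- A continuous function with increments of size `o(δ)` on average over translates by `δ` takes
the same values at the end points. -/
theorem eq_of_integral_increment_le {a b : ℝ} (hab : a < b) {Φ : ℝ → ℝ}
    (hΦ : ContinuousOn Φ (Icc a b))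
    (h : ∀ ε > 0, ∃ δ₀ > 0, ∀ δ ∈ Ioo 0 δ₀, δ < b - a →
      |∫ t in a..(b - δ), (Φ (t + δ) - Φ t)| ≤ δ * ε) : Φ b = Φ a := by
  -- A continuous extension to the line makes the primitive two-sidedly differentiable at `a` and
  -- `b`.
  set Ψ : ℝ → ℝ := IccExtend hab.le ((Icc a b).domRestrict Φ) with hΨ
  have hΨc : Continuous Ψ := by
    rw [hΨ]; exact (continuousOn_iff_continuous_domRestrict.1 hΦ).Icc_extend'
  have hΨe : ∀ t ∈ Icc a b, Ψ t = Φ t := fun t ht => by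
    rw [hΨ, IccExtend_of_mem _ _ ht]; rfl
  have hi : ∀ u v, IntervalIntegrable Ψ volume u v := fun u v => hΨc.intervalIntegrable u v
  set P : ℝ → ℝ := fun t => ∫ s in a..t, Ψ s
  have hP : ∀ t, HasDerivAt P (Ψ t) t := fun t =>
    intervalIntegral.integral_hasDerivAt_right (hi _ _) (hΨc.stronglyMeasurableAtFilter _ _)
      hΨc.continuousAt
  -- This is the integral of the increments, after cancellation of the overlap; its slope at `0` is
  -- `Ψ b - Ψ a`, while the hypothesis forces the slope to vanish.
  set D : ℝ → ℝ := fun δ => P b - P (a + δ) - P (b - δ)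
  have hD : HasDerivAt D (Ψ b - Ψ a) 0 := by
    have h1 : HasDerivAt (fun δ => P (a + δ)) (Ψ a) 0 := by
      have := HasDerivAt.scomp (0 : ℝ) (h := fun δ => a + δ) (h' := 1) (by simpa using hP a)
        ((hasDerivAt_id (0 : ℝ)).const_add a)
      simpa [Function.comp_def] using this
    have h2 : HasDerivAt (fun δ => P (b - δ)) (-Ψ b) 0 := by
      have := HasDerivAt.scomp (0 : ℝ) (h := fun δ => b - δ) (h' := -1) (by simpa using hP b)
        ((hasDerivAt_id (0 : ℝ)).const_sub b)
      simpa [Function.comp_def] using this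
    convert! ((hasDerivAt_const (0 : ℝ) (P b)).sub h1).sub h2 using 1
    ring
  have hDe : ∀ δ, 0 < δ → δ < b - a →
      D δ = ∫ t in a..(b - δ), (Φ (t + δ) - Φ t) := by
    intro δ h0 h1
    have : ∫ t in a..(b - δ), (Φ (t + δ) - Φ t) = ∫ t in a..(b - δ), (Ψ (t + δ) - Ψ t) := by
      refine intervalIntegral.integral_congr fun t ht => ?_
      rw [uIcc_of_le (by linarith)] at ht
      have e1 := hΨe t ⟨ht.1, by linarith [ht.2]⟩
      have e2 := hΨe (t + δ) ⟨by linarith [ht.1], by linarith [ht.2]⟩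
      simp only [e1, e2]
    have hit : ∀ u v, IntervalIntegrable (fun t => Ψ (t + δ)) volume u v := fun u v =>
      (hΨc.comp (continuous_add_const δ)).intervalIntegrable u v
    rw [this, intervalIntegral.integral_sub (hit _ _) (hi _ _),
      intervalIntegral.integral_comp_add_right Ψ δ, sub_add_cancel,
      ← intervalIntegral.integral_interval_sub_left (hi a b) (hi a (a + δ))]
  have hD0 : D 0 = 0 := by simp [D, P]
  have hlim : Tendsto (fun δ => δ⁻¹ * D δ) (𝓝[>] 0) (𝓝 (Ψ b - Ψ a)) := by
    have := hD.hasDerivWithinAt (s := Ioi 0)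
    rw [hasDerivWithinAt_iff_tendsto_slope' (by simp)] at this
    refine this.congr fun δ => ?_
    simp [slope, hD0]
  have hz : |Ψ b - Ψ a| ≤ 0 := by
    refine le_of_forall_pos_le_add fun ε hε => ?_
    obtain ⟨δ₀, hδ₀, hb⟩ := h ε hε
    refine le_of_tendsto hlim.abs ?_
    filter_upwards [Ioo_mem_nhdsGT (lt_min hδ₀ (sub_pos.2 hab))] with δ hδ
    have h3 := hb δ ⟨hδ.1, hδ.2.trans_le (min_le_left _ _)⟩ (hδ.2.trans_le (min_le_right _ _))
    rw [← hDe δ hδ.1 (hδ.2.trans_le (min_le_right _ _))] at h3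
    rw [abs_mul, abs_inv, abs_of_pos hδ.1, zero_add, inv_mul_le_iff₀ hδ.1]
    exact h3
  have := abs_nonpos_iff.1 hz
  rw [hΨe b ⟨hab.le, le_rfl⟩, hΨe a ⟨le_rfl, hab.le⟩] at this
  linarith

theorem integrable_clm_apply {α V : Type*} [MeasurableSpace α] {μ : Measure α}
    [NormedAddCommGroup V] [NormedSpace ℝ V] {ℓ : α → V →L[ℝ] ℝ} {Y : α → V}
    (hℓ : MemLp ℓ 2 μ) (hY : MemLp Y 2 μ) : Integrable (fun s => ℓ s (Y s)) μ := by
  refine (hℓ.norm.integrable_mul hY.norm).mono'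
    (isBoundedBilinearMap_apply.continuous.comp_aestronglyMeasurable (hℓ.1.prodMk hY.1))
    (Eventually.of_forall fun s => (ℓ s).le_opNorm _)

/-- Extension by zero: the translation estimates live on the whole line, and Fubini needs genuinely
measurable representatives. -/
theorem exists_stronglyMeasurable_memLp_ae_eq {α E : Type*} [MeasurableSpace α] {μ : Measure α}
    [NormedAddCommGroup E] {p : ℝ≥0∞} {s : Set α} (hs : MeasurableSet s) {f : α → E}
    (hf : MemLp f p (μ.restrict s)) :
    ∃ g : α → E, StronglyMeasurable g ∧ MemLp g p μ ∧ g =ᵐ[μ.restrict s] f := by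
  refine ⟨s.indicator (hf.1.mk f), hf.1.stronglyMeasurable_mk.indicator hs, ?_, ?_⟩
  · rw [memLp_indicator_iff_restrict hs]
    exact (memLp_congr_ae hf.1.ae_eq_mk).1 hf
  · exact (indicator_ae_eq_restrict hs).trans hf.1.ae_eq_mk.symm

theorem enorm_intervalIntegral_clm_apply_le {V : Type*} [NormedAddCommGroup V] [NormedSpace ℝ V]
    (ℓ : ℝ → V →L[ℝ] ℝ) (Y : ℝ → V) {t δ : ℝ} (hδ : 0 ≤ δ) :
    ‖∫ s in t..(t + δ), ℓ s (Y s)‖ₑ ≤ ∫⁻ s in Ioc t (t + δ), ‖ℓ s‖ₑ * ‖Y s‖ₑ := by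
  rw [intervalIntegral.integral_of_le (by linarith)]
  exact (enorm_integral_le_lintegral_enorm _).trans
    (lintegral_mono fun s => (ℓ s).le_opENorm _)

variable {V H : Type*} [NormedAddCommGroup V] [NormedSpace ℝ V] [NormedAddCommGroup H]
  [InnerProductSpace ℝ H]

/-- No mollification: increments of `⟪x, y⟫` over `[t, t + δ]` are computed by testing one equation
with `Y (t + δ)` and the other with `X t`. Replacing these frozen test vectors by `Y s` and `X s`
costs `o(δ)` on average over `t`, although not at each `t`. -/
theorem inner_sub_inner_eq_integral_of_stronglyMeasurable (ι : V →L[ℝ] H) {a b : ℝ} (hab : a < b)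
    {x y : ℝ → H} {X Y : ℝ → V} {ℓ m : ℝ → V →L[ℝ] ℝ}
    (hx : ContinuousOn x (Icc a b)) (hy : ContinuousOn y (Icc a b))
    (hX : StronglyMeasurable X) (hY : StronglyMeasurable Y)
    (hX2 : MemLp X 2 volume) (hY2 : MemLp Y 2 volume)
    (hιX : ∀ᵐ t ∂volume, t ∈ Icc a b → ι (X t) = x t)
    (hιY : ∀ᵐ t ∂volume, t ∈ Icc a b → ι (Y t) = y t)
    (hℓ : StronglyMeasurable ℓ) (hm : StronglyMeasurable m)
    (hℓ2 : MemLp ℓ 2 volume) (hm2 : MemLp m 2 volume)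
    (hxe : ∀ P, ∀ t ∈ Icc a b, ⟪x t, ι P⟫_ℝ = ⟪x a, ι P⟫_ℝ + ∫ s in a..t, ℓ s P)
    (hye : ∀ P, ∀ t ∈ Icc a b, ⟪y t, ι P⟫_ℝ = ⟪y a, ι P⟫_ℝ + ∫ s in a..t, m s P) :
    ⟪x b, y b⟫_ℝ - ⟪x a, y a⟫_ℝ = ∫ s in a..b, (ℓ s (Y s) + m s (X s)) := by
  have hiℓ : ∀ P u v, IntervalIntegrable (fun s => ℓ s P) volume u v := fun P u v =>
    ((((ContinuousLinearMap.apply ℝ ℝ P).comp_memLp' hℓ2).locallyIntegrable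
      (by norm_num)).integrableOn_isCompact isCompact_uIcc).intervalIntegrable
  have him : ∀ P u v, IntervalIntegrable (fun s => m s P) volume u v := fun P u v =>
    ((((ContinuousLinearMap.apply ℝ ℝ P).comp_memLp' hm2).locallyIntegrable
      (by norm_num)).integrableOn_isCompact isCompact_uIcc).intervalIntegrable
  have hgℓ : Integrable (fun s => ℓ s (Y s)) volume := integrable_clm_apply hℓ2 hY2
  have hgm : Integrable (fun s => m s (X s)) volume := integrable_clm_apply hm2 hX2
  have hg := hgℓ.add hgm
  set G : ℝ → ℝ := fun t => ∫ s in a..t, (ℓ s (Y s) + m s (X s)) with hG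
  have hGc : Continuous G :=
    intervalIntegral.continuous_primitive (fun u v => hg.intervalIntegrable) a
  set Φ : ℝ → ℝ := fun t => ⟪x t, y t⟫_ℝ - G t with hΦ
  have hΦc : ContinuousOn Φ (Icc a b) := (hx.inner hy).sub hGc.continuousOn
  suffices h : Φ b = Φ a by
    have h0 : G a = 0 := by simp [hG]
    have : ⟪x b, y b⟫_ℝ - G b = ⟪x a, y a⟫_ℝ - G a := h
    rw [h0] at this
    change _ = G b
    linarith
  refine eq_of_integral_increment_le hab hΦc fun ε hε => ?_
  obtain ⟨δ₁, hδ₁, h1⟩ := exists_lintegral_translate_le hℓ hY hℓ2 hY2 (half_pos hε)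
  obtain ⟨δ₂, hδ₂, h2⟩ := exists_lintegral_translate_le hm hX hm2 hX2 (half_pos hε)
  refine ⟨min δ₁ δ₂, lt_min hδ₁ hδ₂, fun δ hδ hδb => ?_⟩
  have hδ0 : 0 < δ := hδ.1
  -- `Y` is frozen at the right end of the window (`e = δ`) and `X` at the left end (`e = 0`), so
  -- that the mixed term `⟪x t, y (t + δ)⟫` telescopes.
  have hb1 := h1 δ ⟨hδ0, hδ.2.trans_le (min_le_left _ _)⟩ δ ⟨hδ0.le, le_rfl⟩
  have hb2 := h2 δ ⟨hδ0, hδ.2.trans_le (min_le_right _ _)⟩ 0 ⟨le_rfl, hδ0.le⟩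
  -- The fields represent the states only almost everywhere; translation preserves null sets.
  have hιY' : ∀ᵐ t ∂volume, t + δ ∈ Icc a b → ι (Y (t + δ)) = y (t + δ) :=
    (measurePreserving_add_right (volume : Measure ℝ) δ).quasiMeasurePreserving.ae hιY
  have key : ∀ᵐ t ∂volume, t ∈ Ioc a (b - δ) → ‖Φ (t + δ) - Φ t‖ₑ ≤
      (∫⁻ s in Ioc t (t + δ), ‖ℓ s‖ₑ * ‖Y (t + δ) - Y s‖ₑ)
        + ∫⁻ s in Ioc t (t + δ), ‖m s‖ₑ * ‖X (t + 0) - X s‖ₑ := by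
    filter_upwards [hιX, hιY'] with t hXt hYt htm
    have ht : t ∈ Icc a b := ⟨htm.1.le, by linarith [htm.2]⟩
    have htδ : t + δ ∈ Icc a b := ⟨by linarith [htm.1], by linarith [htm.2]⟩
    have e1 : ⟪x (t + δ), y (t + δ)⟫_ℝ - ⟪x t, y (t + δ)⟫_ℝ
        = ∫ s in t..(t + δ), ℓ s (Y (t + δ)) := by
      rw [← hYt htδ, hxe _ _ htδ, hxe _ _ ht,
        ← intervalIntegral.integral_interval_sub_left (hiℓ _ a (t + δ)) (hiℓ _ a t)]
      ring
    have e2 : ⟪x t, y (t + δ)⟫_ℝ - ⟪x t, y t⟫_ℝ = ∫ s in t..(t + δ), m s (X t) := by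
      rw [real_inner_comm, real_inner_comm (y t), ← hXt ht, hye _ _ htδ, hye _ _ ht,
        ← intervalIntegral.integral_interval_sub_left (him _ a (t + δ)) (him _ a t)]
      ring
    have e3 : G (t + δ) - G t = ∫ s in t..(t + δ), (ℓ s (Y s) + m s (X s)) :=
      intervalIntegral.integral_interval_sub_left hg.intervalIntegrable hg.intervalIntegrable
    have e4 : Φ (t + δ) - Φ t = (∫ s in t..(t + δ), ℓ s (Y (t + δ) - Y s))
        + ∫ s in t..(t + δ), m s (X (t + 0) - X s) := by
      have : Φ (t + δ) - Φ t = (⟪x (t + δ), y (t + δ)⟫_ℝ - ⟪x t, y (t + δ)⟫_ℝ)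
        + (⟪x t, y (t + δ)⟫_ℝ - ⟪x t, y t⟫_ℝ) - (G (t + δ) - G t) := by simp only [hΦ]; ring
      rw [this, e1, e2, e3, intervalIntegral.integral_add hgℓ.intervalIntegrable
        hgm.intervalIntegrable]
      simp only [map_sub, add_zero]
      rw [intervalIntegral.integral_sub (hiℓ _ _ _) hgℓ.intervalIntegrable,
        intervalIntegral.integral_sub (him _ _ _) hgm.intervalIntegrable]
      ring
    rw [e4]
    exact (enorm_add_le _ _).trans (add_le_add
      (enorm_intervalIntegral_clm_apply_le ℓ (fun s => Y (t + δ) - Y s) hδ0.le)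
      (enorm_intervalIntegral_clm_apply_le m (fun s => X (t + 0) - X s) hδ0.le))
  have hfin : ‖∫ t in a..(b - δ), (Φ (t + δ) - Φ t)‖ₑ ≤ ENNReal.ofReal (δ * ε) := by
    rw [intervalIntegral.integral_of_le (by linarith)]
    calc _ ≤ ∫⁻ t in Ioc a (b - δ), ‖Φ (t + δ) - Φ t‖ₑ := enorm_integral_le_lintegral_enorm _
      _ ≤ ∫⁻ t in Ioc a (b - δ), ((∫⁻ s in Ioc t (t + δ), ‖ℓ s‖ₑ * ‖Y (t + δ) - Y s‖ₑ)
        + ∫⁻ s in Ioc t (t + δ), ‖m s‖ₑ * ‖X (t + 0) - X s‖ₑ) :=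
          lintegral_mono_ae ((ae_restrict_iff' measurableSet_Ioc).2 key)
      _ ≤ ∫⁻ t, ((∫⁻ s in Ioc t (t + δ), ‖ℓ s‖ₑ * ‖Y (t + δ) - Y s‖ₑ)
        + ∫⁻ s in Ioc t (t + δ), ‖m s‖ₑ * ‖X (t + 0) - X s‖ₑ) := setLIntegral_le_lintegral _ _
      _ = (∫⁻ t, ∫⁻ s in Ioc t (t + δ), ‖ℓ s‖ₑ * ‖Y (t + δ) - Y s‖ₑ)
        + ∫⁻ t, ∫⁻ s in Ioc t (t + δ), ‖m s‖ₑ * ‖X (t + 0) - X s‖ₑ :=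
          lintegral_add_left (measurable_lintegral_Ioc_add hℓ hY δ δ) _
      _ ≤ ENNReal.ofReal (δ * (ε / 2)) + ENNReal.ofReal (δ * (ε / 2)) := add_le_add hb1 hb2
      _ = _ := by
          rw [← ENNReal.ofReal_add (by positivity) (by positivity)]
          congr 1; ring
  rw [← ofReal_norm, Real.norm_eq_abs] at hfin
  exact (ENNReal.ofReal_le_ofReal_iff (by positivity)).1 hfin

/-- Integration by parts in time for trajectories in `C(T; H) ∩ L²(T; V)` with weak time
derivatives in `L²(T; V')`. -/
theorem inner_sub_inner_eq_integral (ι : V →L[ℝ] H) {a b : ℝ} (hab : a < b)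
    {x y : ℝ → H} {X Y : ℝ → V} {ℓ m : ℝ → V →L[ℝ] ℝ}
    (hx : ContinuousOn x (Icc a b)) (hy : ContinuousOn y (Icc a b))
    (hX : MemLp X 2 (volume.restrict (Icc a b))) (hY : MemLp Y 2 (volume.restrict (Icc a b)))
    (hιX : ∀ᵐ t ∂volume.restrict (Icc a b), ι (X t) = x t)
    (hιY : ∀ᵐ t ∂volume.restrict (Icc a b), ι (Y t) = y t)
    (hℓ : MemLp ℓ 2 (volume.restrict (Icc a b))) (hm : MemLp m 2 (volume.restrict (Icc a b)))
    (hxe : ∀ P, ∀ t ∈ Icc a b, ⟪x t, ι P⟫_ℝ = ⟪x a, ι P⟫_ℝ + ∫ s in a..t, ℓ s P)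
    (hye : ∀ P, ∀ t ∈ Icc a b, ⟪y t, ι P⟫_ℝ = ⟪y a, ι P⟫_ℝ + ∫ s in a..t, m s P) :
    ⟪x b, y b⟫_ℝ - ⟪x a, y a⟫_ℝ = ∫ s in a..b, (ℓ s (Y s) + m s (X s)) := by
  obtain ⟨X', hX1, hX2, hX3⟩ := exists_stronglyMeasurable_memLp_ae_eq measurableSet_Icc hX
  obtain ⟨Y', hY1, hY2, hY3⟩ := exists_stronglyMeasurable_memLp_ae_eq measurableSet_Icc hY
  obtain ⟨ℓ', hℓ1, hℓ2, hℓ3⟩ := exists_stronglyMeasurable_memLp_ae_eq measurableSet_Icc hℓ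
  obtain ⟨m', hm1, hm2, hm3⟩ := exists_stronglyMeasurable_memLp_ae_eq measurableSet_Icc hm
  have hcongr : ∀ {f g : ℝ → ℝ}, f =ᵐ[volume.restrict (Icc a b)] g → ∀ t ∈ Icc a b,
      ∫ s in a..t, f s = ∫ s in a..t, g s := by
    intro f g hfg t ht
    rw [intervalIntegral.integral_of_le ht.1, intervalIntegral.integral_of_le ht.1]
    exact integral_congr_ae (ae_restrict_of_ae_restrict_of_subset
      (Ioc_subset_Icc_self.trans (Icc_subset_Icc le_rfl ht.2)) hfg)
  rw [inner_sub_inner_eq_integral_of_stronglyMeasurable ι hab hx hy hX1 hY1 hX2 hY2 (ℓ := ℓ')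
    (m := m') ?_ ?_ hℓ1 hm1 hℓ2 hm2 ?_ ?_]
  · refine hcongr ?_ b ⟨hab.le, le_rfl⟩
    filter_upwards [hX3, hY3, hℓ3, hm3] with t e1 e2 e3 e4
    rw [e1, e2, e3, e4]
  · rw [← ae_restrict_iff' measurableSet_Icc]
    filter_upwards [hιX, hX3] with t h1 h2
    rw [h2, h1]
  · rw [← ae_restrict_iff' measurableSet_Icc]
    filter_upwards [hιY, hY3] with t h1 h2
    rw [h2, h1]
  · intro P t ht
    rw [hxe P t ht, hcongr (f := fun s => ℓ' s P) (g := fun s => ℓ s P) ?_ t ht]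
    filter_upwards [hℓ3] with s hs
    rw [hs]
  · intro P t ht
    rw [hye P t ht, hcongr (f := fun s => m' s P) (g := fun s => m s P) ?_ t ht]
    filter_upwards [hm3] with s hs
    rw [hs]

end IntegrationByParts

/-! ### Inverses of coercive operators and measurable operator families. -/

section CoerciveOperators

variable {H : Type*} [NormedAddCommGroup H] [InnerProductSpace ℝ H]

/-- A bounded coercive operator becomes a contraction after rescaling and subtraction from the
identity. -/
theorem exists_norm_one_sub_smul_le {m : ℝ} (hm : 0 < m) (K : ℝ) :
    ∃ θ > 0, ∃ q < 1, ∀ A : H →L[ℝ] H, ‖A‖ ≤ K → (∀ u, m * ‖u‖ ^ 2 ≤ ⟪u, A u⟫_ℝ) →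
      ‖1 - (θ : ℝ) • A‖ ≤ (q : ℝ) := by
  -- Enlarging the bound to at least `m` keeps `1 - m ^ 2 / K' ^ 2` nonnegative and `K'` positive.
  set K' := max K m
  have hK' : 0 < K' := hm.trans_le (le_max_right _ _)
  have hq : m ^ 2 / K' ^ 2 ≤ 1 := by
    rw [div_le_one (by positivity)]
    exact pow_le_pow_left₀ hm.le (le_max_right _ _) 2
  have hq' : 0 < m ^ 2 / K' ^ 2 := by positivity
  -- This `θ` minimises `1 - 2 θ m + θ² K'²`, the bound for the squared norm; its minimum is the
  -- radicand.
  refine ⟨m / K' ^ 2, by positivity, √(1 - m ^ 2 / K' ^ 2), ?_, fun A hA hc => ?_⟩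
  · rw [Real.sqrt_lt' one_pos]; linarith
  refine ContinuousLinearMap.opNorm_le_bound _ (Real.sqrt_nonneg _) fun u => ?_
  refine abs_le_of_sq_le_sq' ?_ (by positivity) |>.2
  rw [mul_pow, Real.sq_sqrt (by linarith)]
  have hAu : ‖A u‖ ≤ K' * ‖u‖ :=
    (A.le_opNorm u).trans (mul_le_mul_of_nonneg_right (hA.trans (le_max_left _ _)) (norm_nonneg _))
  have hAu2 : ‖A u‖ ^ 2 ≤ K' ^ 2 * ‖u‖ ^ 2 := by
    rw [← mul_pow]; exact pow_le_pow_left₀ (norm_nonneg _) hAu 2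
  have e : ‖(1 - (m / K' ^ 2) • A) u‖ ^ 2
      = ‖u‖ ^ 2 - 2 * (m / K' ^ 2) * ⟪u, A u⟫_ℝ + (m / K' ^ 2) ^ 2 * ‖A u‖ ^ 2 := by
    simp only [sub_apply, one_apply_eq_self,
      smul_apply]
    rw [norm_sub_sq_real, inner_smul_right, norm_smul, mul_pow, Real.norm_eq_abs, sq_abs]
    ring
  rw [e]
  have h1 : 2 * (m / K' ^ 2) * (m * ‖u‖ ^ 2) ≤ 2 * (m / K' ^ 2) * ⟪u, A u⟫_ℝ :=
    mul_le_mul_of_nonneg_left (hc u) (by positivity)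
  have h2 : (m / K' ^ 2) ^ 2 * ‖A u‖ ^ 2 ≤ (m / K' ^ 2) ^ 2 * (K' ^ 2 * ‖u‖ ^ 2) :=
    mul_le_mul_of_nonneg_left hAu2 (by positivity)
  have h3 : (m / K' ^ 2) ^ 2 * (K' ^ 2 * ‖u‖ ^ 2) = m ^ 2 / K' ^ 2 * ‖u‖ ^ 2 := by
    field_simp
  have h4 : 2 * (m / K' ^ 2) * (m * ‖u‖ ^ 2) = 2 * (m ^ 2 / K' ^ 2 * ‖u‖ ^ 2) := by
    field_simp
  linarith

theorem apply_inverse_of_isUnit {A : H →L[ℝ] H} (hA : IsUnit A) (u : H) :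
    A (Ring.inverse A u) = u := by
  rw [← mul_apply_eq_comp, Ring.mul_inverse_cancel A hA]; rfl

theorem inverse_apply_of_isUnit {A : H →L[ℝ] H} (hA : IsUnit A) (u : H) :
    Ring.inverse A (A u) = u := by
  rw [← mul_apply_eq_comp, Ring.inverse_mul_cancel A hA]; rfl

theorem inner_inverse_of_symm {A : H →L[ℝ] H} (hA : IsUnit A)
    (hs : ∀ u v, ⟪A u, v⟫_ℝ = ⟪u, A v⟫_ℝ) (u v : H) :
    ⟪Ring.inverse A u, v⟫_ℝ = ⟪u, Ring.inverse A v⟫_ℝ := by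
  conv_lhs => rw [← apply_inverse_of_isUnit hA v]
  rw [← hs, apply_inverse_of_isUnit hA]

variable {α : Type*} [MeasurableSpace α] {μ : Measure α}

/-- Measurability is only assumed after application to a fixed vector, so the argument is
approximated by simple functions; on each level set the vector is fixed, and each `B t` is
continuous. -/
theorem aestronglyMeasurable_clm_apply {B : α → H →L[ℝ] H}
    (hB : ∀ v, AEStronglyMeasurable (fun t => B t v) μ) {f : α → H}
    (hf : AEStronglyMeasurable f μ) : AEStronglyMeasurable (fun t => B t (f t)) μ := by
  suffices h : AEStronglyMeasurable (fun t => B t (hf.mk f t)) μ by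
    refine h.congr ?_
    filter_upwards [hf.ae_eq_mk] with t ht
    rw [← ht]
  have hg := hf.stronglyMeasurable_mk
  refine aestronglyMeasurable_of_tendsto_ae atTop (f := fun n t => B t (hg.approx n t)) ?_
    (Eventually.of_forall fun t => ((B t).continuous.tendsto _).comp (hg.tendsto_approx t))
  intro n
  have e : (fun t => B t (hg.approx n t)) = fun t =>
      ∑ v ∈ (hg.approx n).range, (hg.approx n ⁻¹' {v}).indicator (fun t => B t v) t := by
    funext t
    rw [Finset.sum_eq_single (hg.approx n t)]
    · simp [indicator]
    · intro v _ hv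
      exact indicator_of_notMem (fun h => hv (by simpa using h.symm)) _
    · intro h; exact absurd (SimpleFunc.mem_range_self _ _) h
  rw [e]
  exact Finset.aestronglyMeasurable_fun_sum _ fun v _ =>
    (hB v).indicator ((hg.approx n).measurableSet_preimage _)

/-- A bounded strongly measurable family of operators acts on `L²`. -/
theorem exists_Lp_clm {B : α → H →L[ℝ] H} {c : ℝ}
    (hB : ∀ v, AEStronglyMeasurable (fun t => B t v) μ) (hc : ∀ᵐ t ∂μ, ‖B t‖ ≤ c) :
    ∃ M : Lp H 2 μ →L[ℝ] Lp H 2 μ, ∀ u, ∀ᵐ t ∂μ, M u t = B t (u t) := by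
  have hle : ∀ u : α → H, ∀ᵐ t ∂μ, ‖B t (u t)‖ ≤ c * ‖u t‖ := fun u => by
    filter_upwards [hc] with t ht
    exact (B t).le_of_opNorm_le ht _
  have hmem : ∀ u : Lp H 2 μ, MemLp (fun t => B t (u t)) 2 μ := fun u =>
    (Lp.memLp u).of_le_mul (aestronglyMeasurable_clm_apply hB (Lp.aestronglyMeasurable u)) (hle u)
  let M₀ : Lp H 2 μ →ₗ[ℝ] Lp H 2 μ :=
    { toFun := fun u => (hmem u).toLp _
      map_add' := fun u v => by
        rw [← MemLp.toLp_add, MemLp.toLp_eq_toLp_iff]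
        filter_upwards [Lp.coeFn_add u v] with t ht
        change B t ((u + v : Lp H 2 μ) t) = B t (u t) + B t (v t)
        rw [ht, Pi.add_apply, map_add]
      map_smul' := fun r u => by
        rw [RingHom.id_apply, ← MemLp.toLp_const_smul, MemLp.toLp_eq_toLp_iff]
        filter_upwards [Lp.coeFn_smul r u] with t ht
        change B t ((r • u : Lp H 2 μ) t) = r • B t (u t)
        rw [ht, Pi.smul_apply, map_smul] }
  refine ⟨M₀.mkContinuous c fun u => ?_, fun u => (hmem u).coeFn_toLp⟩
  refine Lp.norm_le_mul_norm_of_ae_le_mul ?_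
  filter_upwards [(hmem u).coeFn_toLp, hle u] with t h1 h2
  exact (congrArg norm h1).trans_le h2

variable [CompleteSpace H]

/-- Lax–Milgram by Neumann series: `θ A` is the identity minus a contraction. -/
theorem isUnit_of_coercive {m : ℝ} (hm : 0 < m) {A : H →L[ℝ] H}
    (hc : ∀ u, m * ‖u‖ ^ 2 ≤ ⟪u, A u⟫_ℝ) : IsUnit A := by
  obtain ⟨θ, hθ, q, hq, h⟩ := exists_norm_one_sub_smul_le (H := H) hm ‖A‖
  have h1 := isUnit_one_sub_of_norm_lt_one ((h A le_rfl hc).trans_lt hq)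
  rw [sub_sub_cancel] at h1
  have h2 := h1.smul (Units.mk0 θ⁻¹ (inv_ne_zero hθ.ne'))
  rwa [Units.smul_mk0, smul_smul, inv_mul_cancel₀ hθ.ne', one_smul] at h2

/-- Coercivity at `w = A⁻¹ u` reads `m ‖w‖² ≤ ⟪w, u⟫ ≤ ‖w‖ ‖u‖`. -/
theorem norm_inverse_le_of_coercive {m : ℝ} (hm : 0 < m) {A : H →L[ℝ] H}
    (hc : ∀ u, m * ‖u‖ ^ 2 ≤ ⟪u, A u⟫_ℝ) : ‖Ring.inverse A‖ ≤ m⁻¹ := by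
  refine ContinuousLinearMap.opNorm_le_bound _ (by positivity) fun u => ?_
  have h := (hc (Ring.inverse A u)).trans (real_inner_le_norm _ _)
  rw [apply_inverse_of_isUnit (isUnit_of_coercive hm hc)] at h
  rw [inv_mul_eq_div, le_div_iff₀ hm]
  rcases (norm_nonneg (Ring.inverse A u)).eq_or_lt with h0 | h0
  · rw [← h0]; simp
  · nlinarith

/-- With `w = A⁻¹ u` one has `⟪u, w⟫ = ⟪A w, w⟫ ≥ m ‖w‖²`, and `‖u‖ ≤ K ‖w‖`. -/
theorem inverse_coercive {m K : ℝ} (hm : 0 < m) (hK : 0 < K) {A : H →L[ℝ] H} (hA : ‖A‖ ≤ K)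
    (hc : ∀ u, m * ‖u‖ ^ 2 ≤ ⟪u, A u⟫_ℝ) (u : H) :
    m / K ^ 2 * ‖u‖ ^ 2 ≤ ⟪u, Ring.inverse A u⟫_ℝ := by
  have hu := isUnit_of_coercive hm hc
  set w := Ring.inverse A u
  have hw : A w = u := apply_inverse_of_isUnit hu u
  have h1 : ‖u‖ ≤ K * ‖w‖ := by
    rw [← hw]; exact (A.le_opNorm w).trans (mul_le_mul_of_nonneg_right hA (norm_nonneg _))
  have h2 : ‖u‖ ^ 2 ≤ K ^ 2 * ‖w‖ ^ 2 := by
    rw [← mul_pow]; exact pow_le_pow_left₀ (norm_nonneg _) h1 2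
  have h3 := hc w
  rw [hw, real_inner_comm] at h3
  refine le_trans ?_ h3
  rw [div_mul_eq_mul_div, div_le_iff₀ (by positivity)]
  nlinarith

/-- Pointwise inverses of uniformly coercive strongly measurable operators are strongly
measurable. -/
theorem aestronglyMeasurable_inverse_apply {A : α → H →L[ℝ] H} {m K : ℝ} (hm : 0 < m)
    (hK : ∀ᵐ t ∂μ, ‖A t‖ ≤ K) (hc : ∀ᵐ t ∂μ, ∀ u, m * ‖u‖ ^ 2 ≤ ⟪u, A t u⟫_ℝ)
    (hA : ∀ v, AEStronglyMeasurable (fun t => A t v) μ) (v : H) :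
    AEStronglyMeasurable (fun t => Ring.inverse (A t) v) μ := by
  -- One `θ` serves almost all `t`, so `A t⁻¹ v = ∑ (1 - θ A t)^i (θ v)` is an almost everywhere
  -- limit of measurable partial sums.
  obtain ⟨θ, hθ, q, hq, h⟩ := exists_norm_one_sub_smul_le (H := H) hm K
  have hB : ∀ v, AEStronglyMeasurable (fun t => (1 - θ • A t) v) μ := fun v =>
    aestronglyMeasurable_const.sub ((hA v).const_smul θ)
  have hpow : ∀ i : ℕ, AEStronglyMeasurable (fun t => ((1 - θ • A t) ^ i) (θ • v)) μ := by
    intro i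
    induction i with
    | zero => simpa using aestronglyMeasurable_const
    | succ i ih =>
      simp_rw [pow_succ', mul_apply_eq_comp]
      exact aestronglyMeasurable_clm_apply hB ih
  refine aestronglyMeasurable_of_tendsto_ae atTop
    (f := fun N t => ∑ i ∈ Finset.range N, ((1 - θ • A t) ^ i) (θ • v))
    (fun N => Finset.aestronglyMeasurable_fun_sum _ fun i _ => hpow i) ?_
  filter_upwards [hK, hc] with t hKt hct
  have hs := (hasSum_geom_series_inverse (1 - θ • A t)
    ((h (A t) hKt hct).trans_lt hq)).tendsto_sum_nat
  have hs' := ((ContinuousLinearMap.apply ℝ H (θ • v)).continuous.tendsto _).comp hs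
  have e : Ring.inverse (1 - (1 - θ • A t)) (θ • v) = Ring.inverse (A t) v := by
    have hu := isUnit_of_coercive hm hct
    rw [sub_sub_cancel]
    have hu' : IsUnit (θ • A t) := by
      simpa [Units.smul_def] using hu.smul (Units.mk0 θ hθ.ne')
    conv_lhs => rw [← apply_inverse_of_isUnit hu v]
    exact inverse_apply_of_isUnit hu' (Ring.inverse (A t) v)
  rw [← e]
  refine hs'.congr fun N => ?_
  simp only [Function.comp_apply, ContinuousLinearMap.apply_apply, sum_apply]

end CoerciveOperators

/-! ### Block diagonal operators on stacked controls. -/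

section BlockDiagonal

variable {E F : Type*} [NormedAddCommGroup E] [InnerProductSpace ℝ E] [NormedAddCommGroup F]
  [InnerProductSpace ℝ F]

/-- The block diagonal operator `diag(A, B)` on the Hilbert sum of two spaces. -/
noncomputable def blockDiag (A : E →L[ℝ] E) (B : F →L[ℝ] F) :
    WithLp 2 (E × F) →L[ℝ] WithLp 2 (E × F) :=
  (WithLp.prodContinuousLinearEquiv 2 ℝ E F).symm.toContinuousLinearMap.comp
    ((A.prodMap B).comp (WithLp.prodContinuousLinearEquiv 2 ℝ E F).toContinuousLinearMap)

theorem blockDiag_apply (A : E →L[ℝ] E) (B : F →L[ℝ] F) (u : WithLp 2 (E × F)) :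
    blockDiag A B u = WithLp.toLp 2 (A u.fst, B u.snd) := rfl

theorem inner_blockDiag (A : E →L[ℝ] E) (B : F →L[ℝ] F) (u v : WithLp 2 (E × F)) :
    ⟪u, blockDiag A B v⟫_ℝ = ⟪u.fst, A v.fst⟫_ℝ + ⟪u.snd, B v.snd⟫_ℝ := rfl

theorem blockDiag_symm {A : E →L[ℝ] E} {B : F →L[ℝ] F} (hA : ∀ u v, ⟪A u, v⟫_ℝ = ⟪u, A v⟫_ℝ)
    (hB : ∀ u v, ⟪B u, v⟫_ℝ = ⟪u, B v⟫_ℝ) (u v : WithLp 2 (E × F)) :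
    ⟪blockDiag A B u, v⟫_ℝ = ⟪u, blockDiag A B v⟫_ℝ := by
  rw [real_inner_comm, inner_blockDiag, inner_blockDiag, real_inner_comm, hA,
    real_inner_comm _ v.snd, hB]

theorem blockDiag_coercive {A : E →L[ℝ] E} {B : F →L[ℝ] F} {a b : ℝ}
    (hA : ∀ u, a * ‖u‖ ^ 2 ≤ ⟪u, A u⟫_ℝ) (hB : ∀ u, b * ‖u‖ ^ 2 ≤ ⟪u, B u⟫_ℝ)
    (u : WithLp 2 (E × F)) : min a b * ‖u‖ ^ 2 ≤ ⟪u, blockDiag A B u⟫_ℝ := by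
  rw [inner_blockDiag, WithLp.prod_norm_sq_eq_of_L2, mul_add]
  exact add_le_add
    ((mul_le_mul_of_nonneg_right (min_le_left _ _) (by positivity)).trans (hA _))
    ((mul_le_mul_of_nonneg_right (min_le_right _ _) (by positivity)).trans (hB _))

theorem norm_blockDiag_le {A : E →L[ℝ] E} {B : F →L[ℝ] F} {K : ℝ} (hA : ‖A‖ ≤ K) (hB : ‖B‖ ≤ K) :
    ‖blockDiag A B‖ ≤ K := by
  have hK : 0 ≤ K := (norm_nonneg _).trans hA
  refine ContinuousLinearMap.opNorm_le_bound _ hK fun u => ?_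
  refine abs_le_of_sq_le_sq' ?_ (by positivity) |>.2
  rw [mul_pow, WithLp.prod_norm_sq_eq_of_L2, WithLp.prod_norm_sq_eq_of_L2, mul_add,
    blockDiag_apply, ← mul_pow, ← mul_pow]
  exact add_le_add (pow_le_pow_left₀ (norm_nonneg _) (A.le_of_opNorm_le hA _) 2)
    (pow_le_pow_left₀ (norm_nonneg _) (B.le_of_opNorm_le hB _) 2)

end BlockDiagonal

/-! ### Linearisation of the state and expansion of the cost. -/

section Trajectories

variable {V H : Type*} [NormedAddCommGroup V] [NormedSpace ℝ V] [NormedAddCommGroup H]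
  [InnerProductSpace ℝ H] {ι : V →L[ℝ] H} {t₀ tf : ℝ}

/-- `C(T; H) ∩ L₂(T; V)`, for an abstract pair of spaces `ι : V → H`. -/
structure IsTrajectory (ι : V →L[ℝ] H) (t₀ tf : ℝ) (x : ℝ → H × V) : Prop where
  cont : ContinuousOn (fun t => (x t).1) (Icc t₀ tf)
  memLp : MemLp (fun t => (x t).2) 2 (timeMeasure t₀ tf)
  val_eq : ∀ᵐ t ∂timeMeasure t₀ tf, ι (x t).2 = (x t).1

/-- The norm of `C(T; H) ∩ L₂(T; V)`. -/
noncomputable def trajNorm (t₀ tf : ℝ) (x : ℝ → H × V) : ℝ :=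
  sSup ((fun t => ‖(x t).1‖) '' Icc t₀ tf)
    + (eLpNorm (fun t => (x t).2) 2 (timeMeasure t₀ tf)).toReal

/-- `dx/dt = ℓ` weakly on `T`, with `ℓ` in `L₂(T; V')`. -/
structure HasTrajDeriv (ι : V →L[ℝ] H) (t₀ tf : ℝ) (x : ℝ → H × V)
    (ℓ : ℝ → (V →L[ℝ] ℝ)) : Prop where
  isPath : IsTrajectory ι t₀ tf x
  memLp : MemLp ℓ 2 (timeMeasure t₀ tf)
  eq : ∀ P : V, ∀ t ∈ Icc t₀ tf,
    ⟪(x t).1, ι P⟫_ℝ = ⟪(x t₀).1, ι P⟫_ℝ + ∫ s in t₀..t, ℓ s P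

theorem IsTrajectory.sub {x y : ℝ → H × V} (hx : IsTrajectory ι t₀ tf x) (hy : IsTrajectory ι t₀ tf y) :
    IsTrajectory ι t₀ tf (x - y) where
  cont := hx.cont.sub hy.cont
  memLp := hx.memLp.sub hy.memLp
  val_eq := by
    filter_upwards [hx.val_eq, hy.val_eq] with t h1 h2
    rw [Pi.sub_apply, Prod.snd_sub, Prod.fst_sub, map_sub, h1, h2]

theorem IsTrajectory.const_smul {x : ℝ → H × V} (hx : IsTrajectory ι t₀ tf x) (c : ℝ) :
    IsTrajectory ι t₀ tf (c • x) where
  cont := hx.cont.const_smul c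
  memLp := hx.memLp.const_smul c
  val_eq := by
    filter_upwards [hx.val_eq] with t h1
    rw [Pi.smul_apply, Prod.smul_snd, Prod.smul_fst, map_smul, h1]

theorem IsTrajectory.bddAbove {x : ℝ → H × V} (hx : IsTrajectory ι t₀ tf x) :
    BddAbove ((fun t => ‖(x t).1‖) '' Icc t₀ tf) :=
  isCompact_Icc.bddAbove_image hx.cont.norm

theorem trajNorm_nonneg {V H : Type*} [NormedAddCommGroup V] [NormedAddCommGroup H] (x : ℝ → H × V) : 0 ≤ trajNorm t₀ tf x := by
  refine add_nonneg (Real.sSup_nonneg ?_) ENNReal.toReal_nonneg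
  rintro _ ⟨t, -, rfl⟩
  exact norm_nonneg _

theorem IsTrajectory.norm_le_trajNorm {x : ℝ → H × V} (hx : IsTrajectory ι t₀ tf x) {t : ℝ}
    (ht : t ∈ Icc t₀ tf) : ‖(x t).1‖ ≤ trajNorm t₀ tf x :=
  (le_csSup hx.bddAbove (mem_image_of_mem _ ht)).trans (le_add_of_nonneg_right ENNReal.toReal_nonneg)

theorem trajNorm_le_add_sub (h : t₀ ≤ tf) {x y : ℝ → H × V} (hx : IsTrajectory ι t₀ tf x)
    (hy : IsTrajectory ι t₀ tf y) : trajNorm t₀ tf x ≤ trajNorm t₀ tf y + trajNorm t₀ tf (x - y) := by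
  have h1 : sSup ((fun t => ‖(x t).1‖) '' Icc t₀ tf) ≤ sSup ((fun t => ‖(y t).1‖) '' Icc t₀ tf)
      + sSup ((fun t => ‖((x - y) t).1‖) '' Icc t₀ tf) := by
    refine csSup_le ((nonempty_Icc.2 h).image _) ?_
    rintro _ ⟨t, ht, rfl⟩
    refine le_trans ?_ (add_le_add (le_csSup hy.bddAbove (mem_image_of_mem _ ht))
      (le_csSup (hx.sub hy).bddAbove (mem_image_of_mem _ ht)))
    simpa using norm_add_le (y t).1 ((x t).1 - (y t).1)
  have h2 : (eLpNorm (fun t => (x t).2) 2 (timeMeasure t₀ tf)).toReal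
      ≤ (eLpNorm (fun t => (y t).2) 2 (timeMeasure t₀ tf)).toReal
        + (eLpNorm (fun t => ((x - y) t).2) 2 (timeMeasure t₀ tf)).toReal := by
    rw [← ENNReal.toReal_add hy.memLp.2.ne (hx.sub hy).memLp.2.ne]
    refine ENNReal.toReal_mono (ENNReal.add_ne_top.2 ⟨hy.memLp.2.ne, (hx.sub hy).memLp.2.ne⟩) ?_
    refine le_trans (le_of_eq ?_) (eLpNorm_add_le hy.memLp.1 (hx.sub hy).memLp.1 (by norm_num))
    congr 1
    funext t
    simp
  unfold trajNorm
  linarith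

theorem trajNorm_smul_le (h : t₀ ≤ tf) {x : ℝ → H × V} (hx : IsTrajectory ι t₀ tf x) (c : ℝ) :
    trajNorm t₀ tf (c • x) ≤ |c| * trajNorm t₀ tf x := by
  have h1 : sSup ((fun t => ‖((c • x) t).1‖) '' Icc t₀ tf)
      ≤ |c| * sSup ((fun t => ‖(x t).1‖) '' Icc t₀ tf) := by
    refine csSup_le ((nonempty_Icc.2 h).image _) ?_
    rintro _ ⟨t, ht, rfl⟩
    change ‖c • (x t).1‖ ≤ _
    rw [norm_smul, Real.norm_eq_abs]
    exact mul_le_mul_of_nonneg_left (le_csSup hx.bddAbove (mem_image_of_mem _ ht)) (abs_nonneg _)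
  have h2 : (eLpNorm (fun t => ((c • x) t).2) 2 (timeMeasure t₀ tf)).toReal
      = |c| * (eLpNorm (fun t => (x t).2) 2 (timeMeasure t₀ tf)).toReal := by
    have := eLpNorm_const_smul c (fun t => (x t).2) 2 (timeMeasure t₀ tf)
    rw [show (fun t => ((c • x) t).2) = c • fun t => (x t).2 from rfl, this, ENNReal.toReal_mul]
    simp
  unfold trajNorm
  rw [h2, mul_add]
  linarith

theorem memLp_intervalIntegrable_apply {E : Type*} [NormedAddCommGroup E] [NormedSpace ℝ E]
    {ℓ : ℝ → E →L[ℝ] ℝ} (hℓ : MemLp ℓ 2 (timeMeasure t₀ tf)) (P : E) {t : ℝ}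
    (ht : t ∈ Icc t₀ tf) : IntervalIntegrable (fun s => ℓ s P) volume t₀ t := by
  have : IsFiniteMeasure (timeMeasure t₀ tf) := by unfold timeMeasure; infer_instance
  have h : Integrable (fun s => ℓ s P) (timeMeasure t₀ tf) :=
    ((ContinuousLinearMap.apply ℝ ℝ P).comp_memLp' hℓ).integrable (by norm_num)
  rw [intervalIntegrable_iff_integrableOn_Icc_of_le ht.1]
  exact IntegrableOn.mono_set (t := Icc t₀ tf) h (Icc_subset_Icc le_rfl ht.2)

theorem HasTrajDeriv.sub {x y : ℝ → H × V} {ℓ m : ℝ → V →L[ℝ] ℝ}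
    (hx : HasTrajDeriv ι t₀ tf x ℓ) (hy : HasTrajDeriv ι t₀ tf y m) :
    HasTrajDeriv ι t₀ tf (x - y) (ℓ - m) where
  isPath := hx.isPath.sub hy.isPath
  memLp := hx.memLp.sub hy.memLp
  eq P t ht := by
    simp only [Pi.sub_apply, Prod.fst_sub, inner_sub_left, sub_apply]
    rw [hx.eq P t ht, hy.eq P t ht,
      intervalIntegral.integral_sub (memLp_intervalIntegrable_apply hx.memLp P ht)
        (memLp_intervalIntegrable_apply hy.memLp P ht)]
    ring

theorem HasTrajDeriv.const_smul {x : ℝ → H × V} {ℓ : ℝ → V →L[ℝ] ℝ}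
    (hx : HasTrajDeriv ι t₀ tf x ℓ) (c : ℝ) : HasTrajDeriv ι t₀ tf (c • x) (c • ℓ) where
  isPath := hx.isPath.const_smul c
  memLp := hx.memLp.const_smul c
  eq P t ht := by
    simp only [Pi.smul_apply, Prod.smul_fst, real_inner_smul_left, smul_apply, smul_eq_mul]
    rw [hx.eq P t ht, intervalIntegral.integral_const_mul]
    ring

/-- Integration by parts in time for two state trajectories. -/
theorem HasTrajDeriv.inner_sub_inner (h : t₀ < tf) {x y : ℝ → H × V}
    {ℓ m : ℝ → V →L[ℝ] ℝ} (hx : HasTrajDeriv ι t₀ tf x ℓ)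
    (hy : HasTrajDeriv ι t₀ tf y m) :
    ⟪(x tf).1, (y tf).1⟫_ℝ - ⟪(x t₀).1, (y t₀).1⟫_ℝ
      = ∫ s in t₀..tf, (ℓ s (y s).2 + m s (x s).2) :=
  inner_sub_inner_eq_integral ι h hx.isPath.cont hy.isPath.cont hx.isPath.memLp hy.isPath.memLp
    hx.isPath.val_eq hy.isPath.val_eq hx.memLp hy.memLp hx.eq hy.eq

theorem intervalIntegrable_inner (ht : t₀ ≤ tf) {E : Type*} [NormedAddCommGroup E]
    [InnerProductSpace ℝ E] {f g : ℝ → E} (hf : MemLp f 2 (timeMeasure t₀ tf))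
    (hg : MemLp g 2 (timeMeasure t₀ tf)) :
    IntervalIntegrable (fun t => ⟪f t, g t⟫_ℝ) volume t₀ tf := by
  rw [intervalIntegrable_iff_integrableOn_Icc_of_le ht]
  exact (hf.norm.integrable_mul hg.norm).mono' (hf.1.inner hg.1)
    (Eventually.of_forall fun t => norm_inner_le_norm _ _)

theorem IsTrajectory.memLp_fst {x : ℝ → H × V} (hx : IsTrajectory ι t₀ tf x) :
    MemLp (fun t => (x t).1) 2 (timeMeasure t₀ tf) :=
  (ι.comp_memLp' hx.memLp).ae_eq hx.val_eq

theorem eventually_eLpNorm_smul_lt {E : Type*} [NormedAddCommGroup E] [NormedSpace ℝ E] {v : ℝ → E}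
    (hv : MemLp v 2 (timeMeasure t₀ tf)) {δ : ℝ} (hδ : 0 < δ) :
    ∀ᶠ γ in 𝓝 (0 : ℝ), eLpNorm (γ • v) 2 (timeMeasure t₀ tf) < ENNReal.ofReal δ := by
  have h1 : Tendsto (fun γ : ℝ => ‖γ‖ₑ * eLpNorm v 2 (timeMeasure t₀ tf)) (𝓝 0) (𝓝 0) := by
    have := ENNReal.Tendsto.mul_const (b := eLpNorm v 2 (timeMeasure t₀ tf))
      (continuous_enorm.tendsto (0 : ℝ)) (Or.inr hv.2.ne)
    simpa using this
  filter_upwards [h1.eventually (gt_mem_nhds (ENNReal.ofReal_pos.2 hδ))] with γ hγ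
  rwa [eLpNorm_const_smul]

/-- A curve of solutions whose nonlinear remainder is of second order agrees with its linearisation
up to second order. -/
theorem trajNorm_linearisation_le (ht : t₀ < tf) {𝓐 : ℝ → V →ₗ[ℝ] (V →L[ℝ] ℝ)}
    (hstab : ∃ K : ℝ, ∀ (ℓ : ℝ → (V →L[ℝ] ℝ)) (y : ℝ → H × V), MemLp ℓ 2 (timeMeasure t₀ tf) →
      HasTrajDeriv ι t₀ tf y (fun t => 𝓐 t (y t).2 + ℓ t) →
      trajNorm t₀ tf y ≤ K * (‖(y t₀).1‖ + (eLpNorm ℓ 2 (timeMeasure t₀ tf)).toReal))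
    {δX : ℝ → H × V} {ℓδ : ℝ → V →L[ℝ] ℝ}
    (hδX : HasTrajDeriv ι t₀ tf δX (fun t => 𝓐 t (δX t).2 + ℓδ t)) (hδ0 : (δX t₀).1 = 0)
    {x : ℝ → H × V} {xγ : ℝ → ℝ → H × V} {f : ℝ → V →L[ℝ] ℝ} {fγ : ℝ → ℝ → V →L[ℝ] ℝ}
    (hx : HasTrajDeriv ι t₀ tf x f) (hxγ : ∀ γ, HasTrajDeriv ι t₀ tf (xγ γ) (fγ γ))
    (hx0 : ∀ γ, (xγ γ t₀).1 = (x t₀).1)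
    (hcont : ∀ ε > 0, ∀ᶠ γ in 𝓝 0, trajNorm t₀ tf (xγ γ - x) < ε)
    (hR : ∃ K : ℝ, ∃ r > 0, ∀ γ : ℝ, |γ| ≤ r → trajNorm t₀ tf (xγ γ - x) ≤ r →
      MemLp (fun t => fγ γ t - f t - (𝓐 t (xγ γ t - x t).2 + γ • ℓδ t)) 2 (timeMeasure t₀ tf) ∧
      eLpNorm (fun t => fγ γ t - f t - (𝓐 t (xγ γ t - x t).2 + γ • ℓδ t)) 2 (timeMeasure t₀ tf)
        ≤ ENNReal.ofReal (K * (trajNorm t₀ tf (xγ γ - x) + |γ|) ^ 2)) :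
    ∃ K, 0 ≤ K ∧ ∀ᶠ γ in 𝓝 (0 : ℝ), trajNorm t₀ tf (xγ γ - x) ≤ K * |γ| ∧
      trajNorm t₀ tf (xγ γ - x - γ • δX) ≤ K * γ ^ 2 := by
  obtain ⟨K₁, r, hr, hR⟩ := hR
  obtain ⟨K₂, hK₂⟩ := hstab
  set K := |K₂| * |K₁| with hK
  have hK0 : 0 ≤ K := by positivity
  set N := trajNorm t₀ tf δX
  have hN0 : 0 ≤ N := trajNorm_nonneg _
  -- Small enough for the expansion to apply, and for `K (p + |γ|) ≤ 1 / 2` once `p` and `|γ|` are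
  -- below `ε`.
  set ε := min r (1 / (4 * (K + 1))) with hε
  have hε0 : 0 < ε := lt_min hr (by positivity)
  have hKε : K * (2 * ε) ≤ 1 / 2 := by
    have h1 : ε ≤ 1 / (4 * (K + 1)) := min_le_right _ _
    rw [le_div_iff₀ (by positivity)] at h1
    nlinarith
  have hγε : ∀ᶠ γ in 𝓝 (0 : ℝ), |γ| < ε := by
    have := (continuous_abs.tendsto (0 : ℝ))
    rw [abs_zero] at this
    exact this.eventually (gt_mem_nhds hε0)
  refine ⟨max (2 * N + 1) (K * (2 * N + 2) ^ 2), le_max_of_le_left (by positivity), ?_⟩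
  filter_upwards [hcont ε hε0, hγε] with γ hhε h3
  set h := xγ γ - x with hh
  have hhp : IsTrajectory ι t₀ tf h := (hxγ γ).isPath.sub hx.isPath
  obtain ⟨hRm, hRle⟩ := hR γ (h3.le.trans (min_le_left _ _)) (hhε.le.trans (min_le_left _ _))
  set R : ℝ → (V →L[ℝ] ℝ) := fun t => fγ γ t - f t - (𝓐 t (xγ γ t - x t).2 + γ • ℓδ t) with hRdef
  have hy := ((hxγ γ).sub hx).sub (hδX.const_smul γ)
  rw [← hh] at hy
  -- The linearisation error solves the linear system with the remainder `R` as its only forcing.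
  have hy' : HasTrajDeriv ι t₀ tf (h - γ • δX) (fun t => 𝓐 t ((h - γ • δX) t).2 + R t) := by
    convert hy using 1
    funext t
    simp only [hRdef, hh, Pi.sub_apply, Pi.smul_apply, Prod.snd_sub, Prod.smul_snd, map_sub,
      map_smul, smul_add]
    abel
  have hy0 : ((h - γ • δX) t₀).1 = 0 := by
    simp [hh, hx0, hδ0]
  have hyle := hK₂ R _ hRm hy'
  rw [hy0, norm_zero, zero_add] at hyle
  set p := trajNorm t₀ tf h
  have hp0 : 0 ≤ p := trajNorm_nonneg _
  have hRle' : (eLpNorm R 2 (timeMeasure t₀ tf)).toReal ≤ |K₁| * (p + |γ|) ^ 2 := by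
    refine ENNReal.toReal_le_of_le_ofReal (by positivity) (hRle.trans ?_)
    exact ENNReal.ofReal_le_ofReal (mul_le_mul_of_nonneg_right (le_abs_self _) (by positivity))
  have hyle' : trajNorm t₀ tf (h - γ • δX) ≤ K * (p + |γ|) ^ 2 := by
    refine hyle.trans ((mul_le_mul_of_nonneg_right (le_abs_self _) ENNReal.toReal_nonneg).trans ?_)
    rw [hK, mul_assoc]
    exact mul_le_mul_of_nonneg_left hRle' (abs_nonneg _)
  have hple : p ≤ |γ| * N + K * (p + |γ|) ^ 2 :=
    (trajNorm_le_add_sub ht.le hhp (hδX.isPath.const_smul γ)).trans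
      (add_le_add (trajNorm_smul_le ht.le hδX.isPath γ) hyle')
  have hγ0 : 0 ≤ |γ| := abs_nonneg _
  -- One factor of the square is absorbed by smallness; half of `p` then moves to the left, turning
  -- mere continuity into the linear bound `p ≤ (2 N + 1) |γ|`.
  have hquad : K * (p + |γ|) ^ 2 ≤ 1 / 2 * (p + |γ|) := by
    have h4 : K * (p + |γ|) ≤ 1 / 2 :=
      (mul_le_mul_of_nonneg_left (by linarith) hK0).trans hKε
    calc K * (p + |γ|) ^ 2 = K * (p + |γ|) * (p + |γ|) := by ring
      _ ≤ _ := mul_le_mul_of_nonneg_right h4 (by positivity)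
  have hpγ : p ≤ (2 * N + 1) * |γ| := by linarith
  refine ⟨hpγ.trans (mul_le_mul_of_nonneg_right (le_max_left _ _) hγ0), hyle'.trans ?_⟩
  calc K * (p + |γ|) ^ 2 ≤ K * ((2 * N + 2) * |γ|) ^ 2 := by
        refine mul_le_mul_of_nonneg_left (pow_le_pow_left₀ (by positivity) (by linarith) 2) hK0
    _ = K * (2 * N + 2) ^ 2 * γ ^ 2 := by rw [mul_pow, sq_abs]; ring
    _ ≤ _ := mul_le_mul_of_nonneg_right (le_max_right _ _) (by positivity)

/-- The change of the cost along a curve of states that is differentiable up to second order. -/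
theorem cost_expansion (ht : t₀ < tf) {E F : Type*} [NormedAddCommGroup E]
    [InnerProductSpace ℝ E] [NormedAddCommGroup F] [InnerProductSpace ℝ F]
    {L : ℝ → H → E → F → ℝ} {φ : H → ℝ} {LX : ℝ → H} {Ld : ℝ → E} {Lb : ℝ → F} {φX : H}
    (hLX : MemLp LX 2 (timeMeasure t₀ tf)) (hLd : MemLp Ld 2 (timeMeasure t₀ tf))
    (hLb : MemLp Lb 2 (timeMeasure t₀ tf))
    {x δX : ℝ → H × V} (hx : IsTrajectory ι t₀ tf x) (hδX : IsTrajectory ι t₀ tf δX)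
    {ud vd : ℝ → E} {ub vb : ℝ → F}
    (hvd : MemLp vd 2 (timeMeasure t₀ tf)) (hvb : MemLp vb 2 (timeMeasure t₀ tf))
    (hL : ∃ K : ℝ, ∃ r > 0, ∀ (γ : ℝ) (h : ℝ → H × V), |γ| ≤ r → IsTrajectory ι t₀ tf h →
      trajNorm t₀ tf h ≤ r →
      IntegrableOn (fun t => L t ((x t).1 + (h t).1) (ud t + γ • vd t) (ub t + γ • vb t))
        (Icc t₀ tf) ∧
      |∫ t in t₀..tf, (L t ((x t).1 + (h t).1) (ud t + γ • vd t) (ub t + γ • vb t)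
          - L t (x t).1 (ud t) (ub t)
          - (⟪LX t, (h t).1⟫_ℝ + ⟪Ld t, γ • vd t⟫_ℝ + ⟪Lb t, γ • vb t⟫_ℝ))|
        ≤ K * (trajNorm t₀ tf h + |γ|) ^ 2)
    (hφ : ∃ K : ℝ, ∃ r > 0, ∀ h : H, ‖h‖ ≤ r →
      |φ ((x tf).1 + h) - φ (x tf).1 - ⟪φX, h⟫_ℝ| ≤ K * ‖h‖ ^ 2)
    {xγ : ℝ → ℝ → H × V} (hxγ : ∀ γ, IsTrajectory ι t₀ tf (xγ γ)) {K : ℝ} (hK : 0 ≤ K)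
    (hest : ∀ᶠ γ in 𝓝 (0 : ℝ), trajNorm t₀ tf (xγ γ - x) ≤ K * |γ| ∧
      trajNorm t₀ tf (xγ γ - x - γ • δX) ≤ K * γ ^ 2) :
    (fun γ : ℝ => (φ (xγ γ tf).1
        + ∫ t in t₀..tf, L t (xγ γ t).1 (ud t + γ • vd t) (ub t + γ • vb t))
      - (φ (x tf).1 + ∫ t in t₀..tf, L t (x t).1 (ud t) (ub t))
      - γ * (⟪φX, (δX tf).1⟫_ℝ + ∫ t in t₀..tf, (⟪LX t, (δX t).1⟫_ℝ
        + ⟪Ld t, vd t⟫_ℝ + ⟪Lb t, vb t⟫_ℝ))) =O[𝓝 0] (fun γ => γ ^ 2) := by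
  obtain ⟨K₁, r₁, hr₁, hL⟩ := hL
  obtain ⟨K₂, r₂, hr₂, hφ⟩ := hφ
  have hsm : ∀ ε > 0, ∀ᶠ γ in 𝓝 (0 : ℝ), (K + 1) * |γ| < ε := fun ε hε => by
    have : Tendsto (fun γ : ℝ => (K + 1) * |γ|) (𝓝 0) (𝓝 ((K + 1) * |0|)) :=
      (continuous_const.mul continuous_abs).tendsto 0
    rw [abs_zero, mul_zero] at this
    exact this.eventually (gt_mem_nhds hε)
  have hfin : IsFiniteMeasure (timeMeasure t₀ tf) := by unfold timeMeasure; infer_instance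
  have hLXi : IntervalIntegrable (fun t => ‖LX t‖) volume t₀ tf := by
    rw [intervalIntegrable_iff_integrableOn_Icc_of_le ht.le]
    exact (hLX.integrable (by norm_num)).norm
  set c := ∫ t in t₀..tf, ‖LX t‖
  have hc : 0 ≤ c := intervalIntegral.integral_nonneg ht.le fun _ _ => norm_nonneg _
  have htf : tf ∈ Icc t₀ tf := ⟨ht.le, le_rfl⟩
  -- The four terms come from the remainder of `φ`, the remainder of `L`, and the linearisation
  -- error `y = h - γ δX` paired with `φX` and with `LX`.
  refine Asymptotics.IsBigO.of_bound
    (|K₂| * K ^ 2 + |K₁| * (K + 1) ^ 2 + ‖φX‖ * K + c * K) ?_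
  filter_upwards [hest, hsm r₁ hr₁, hsm r₂ hr₂] with γ hγ h1 h2
  set h := xγ γ - x with hh
  set y := h - γ • δX with hy
  have hhp : IsTrajectory ι t₀ tf h := (hxγ γ).sub hx
  have hyp : IsTrajectory ι t₀ tf y := hhp.sub (hδX.const_smul γ)
  have hγ0 : 0 ≤ |γ| := abs_nonneg γ
  have hKγ : 0 ≤ K * |γ| := by positivity
  set p := trajNorm t₀ tf h with hp
  have hp0 : 0 ≤ p := trajNorm_nonneg _
  obtain ⟨hLi, hLe⟩ := hL γ h (by linarith) hhp (by linarith [hγ.1])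
  -- The zero variation gives integrability of `L` along the nominal trajectory, needed to split the
  -- integral.
  obtain ⟨hLi0, -⟩ := hL 0 0 (by simpa using hr₁.le) (by simpa using hx.sub hx) (by
    have h0 := trajNorm_smul_le ht.le hx 0
    rw [zero_smul, abs_zero, zero_mul] at h0
    exact h0.trans hr₁.le)
  have hnorm : ‖(h tf).1‖ ≤ p := hhp.norm_le_trajNorm htf
  have hφe := hφ (h tf).1 (by linarith [hγ.1])
  have ex : ∀ t, (x t).1 + (h t).1 = (xγ γ t).1 := fun t => by simp [hh]
  have eh : ∀ t, (h t).1 = (y t).1 + γ • (δX t).1 := fun t => by simp [hy]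
  simp only [ex] at hLi hLe hφe
  have hi0 : IntervalIntegrable (fun t => L t (x t).1 (ud t) (ub t)) volume t₀ tf := by
    rw [intervalIntegrable_iff_integrableOn_Icc_of_le ht.le]
    simpa using hLi0
  have hi : IntervalIntegrable
      (fun t => L t (xγ γ t).1 (ud t + γ • vd t) (ub t + γ • vb t)) volume t₀ tf := by
    rwa [intervalIntegrable_iff_integrableOn_Icc_of_le ht.le]
  have hj1 := intervalIntegrable_inner ht.le hLX hyp.memLp_fst
  have hj2 := intervalIntegrable_inner ht.le hLX hδX.memLp_fst
  have hj3 := intervalIntegrable_inner ht.le hLd hvd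
  have hj4 := intervalIntegrable_inner ht.le hLb hvb
  have hj := (hj2.add hj3).add hj4
  have elin : (fun t => ⟪LX t, (h t).1⟫_ℝ + ⟪Ld t, γ • vd t⟫_ℝ + ⟪Lb t, γ • vb t⟫_ℝ)
      = fun t => ⟪LX t, (y t).1⟫_ℝ + γ * (⟪LX t, (δX t).1⟫_ℝ
        + ⟪Ld t, vd t⟫_ℝ + ⟪Lb t, vb t⟫_ℝ) := by
    funext t
    rw [eh, inner_add_right, inner_smul_right, inner_smul_right, inner_smul_right]
    ring
  have hlin : IntervalIntegrable (fun t => ⟪LX t, (h t).1⟫_ℝ + ⟪Ld t, γ • vd t⟫_ℝ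
      + ⟪Lb t, γ • vb t⟫_ℝ) volume t₀ tf := by
    rw [elin]; exact hj1.add (hj.const_mul γ)
  rw [intervalIntegral.integral_sub (hi.sub hi0) hlin, intervalIntegral.integral_sub hi hi0, elin,
    intervalIntegral.integral_add hj1 (hj.const_mul γ), intervalIntegral.integral_const_mul] at hLe
  rw [eh, inner_add_right, inner_smul_right] at hφe
  have hIy : |∫ t in t₀..tf, ⟪LX t, (y t).1⟫_ℝ| ≤ c * (K * γ ^ 2) := by
    have h3 : |∫ t in t₀..tf, ⟪LX t, (y t).1⟫_ℝ|
        ≤ ∫ t in t₀..tf, ‖LX t‖ * (K * γ ^ 2) := by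
      refine (intervalIntegral.abs_integral_le_integral_abs ht.le).trans
        (intervalIntegral.integral_mono_on ht.le hj1.abs (hLXi.mul_const _) fun t htt => ?_)
      refine (abs_real_inner_le_norm _ _).trans
        (mul_le_mul_of_nonneg_left ((hyp.norm_le_trajNorm htt).trans hγ.2) (norm_nonneg _))
    rwa [intervalIntegral.integral_mul_const] at h3
  have hφy : |⟪φX, (y tf).1⟫_ℝ| ≤ ‖φX‖ * (K * γ ^ 2) :=
    (abs_real_inner_le_norm _ _).trans
      (mul_le_mul_of_nonneg_left ((hyp.norm_le_trajNorm htf).trans hγ.2) (norm_nonneg _))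
  have hb1 : K₂ * ‖(y tf).1 + γ • (δX tf).1‖ ^ 2 ≤ |K₂| * K ^ 2 * γ ^ 2 := by
    rw [← eh]
    have h4 : ‖(h tf).1‖ ^ 2 ≤ (K * |γ|) ^ 2 :=
      pow_le_pow_left₀ (norm_nonneg _) (hnorm.trans hγ.1) 2
    rw [mul_pow, sq_abs] at h4
    rw [mul_assoc]
    exact (mul_le_mul_of_nonneg_right (le_abs_self _) (by positivity)).trans
      (mul_le_mul_of_nonneg_left h4 (abs_nonneg _))
  have hb2 : K₁ * (p + |γ|) ^ 2 ≤ |K₁| * (K + 1) ^ 2 * γ ^ 2 := by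
    have h4 : (p + |γ|) ^ 2 ≤ ((K + 1) * |γ|) ^ 2 :=
      pow_le_pow_left₀ (by positivity) (by linarith [hγ.1]) 2
    rw [mul_pow, sq_abs] at h4
    rw [mul_assoc]
    exact (mul_le_mul_of_nonneg_right (le_abs_self _) (by positivity)).trans
      (mul_le_mul_of_nonneg_left h4 (abs_nonneg _))
  rw [Real.norm_eq_abs, Real.norm_eq_abs, abs_of_nonneg (sq_nonneg γ)]
  have g1 := abs_le.1 (hφe.trans hb1)
  have g2 := abs_le.1 (hLe.trans hb2)
  have g3 := abs_le.1 hIy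
  have g4 := abs_le.1 hφy
  rw [abs_le]
  constructor <;> linarith [g1.1, g1.2, g2.1, g2.2, g3.1, g3.2, g4.1, g4.2]

end Trajectories

/-! ### Weak forms, the adjoint pairing and the first variation. -/

section WeakForms

variable {V H S E F ν : Type*} [Fintype ν] [NormedAddCommGroup V] [NormedSpace ℝ V]
  [NormedAddCommGroup H] [InnerProductSpace ℝ H] [NormedAddCommGroup S] [InnerProductSpace ℝ S]
  [NormedAddCommGroup E] [InnerProductSpace ℝ E] [NormedAddCommGroup F] [InnerProductSpace ℝ F]

/-- The functional `P ↦ -∑ᵢ ⟨aᵢ, ∂ᵢP⟩ + ⟨f, P⟩ - ⟨g, P⟩_S`, for abstract derivatives `gr`,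
value `vl` and trace `tc`. -/
noncomputable def pairForm (gr : ν → V →L[ℝ] H) (vl : V →L[ℝ] H) (tc : V →L[ℝ] S)
    (a : ν → H) (f : H) (g : S) : V →L[ℝ] ℝ :=
  -(∑ i, (innerSL ℝ (a i)).comp (gr i)) + (innerSL ℝ f).comp vl - (innerSL ℝ g).comp tc

/-- The functional `P ↦ -∑ᵢ ⟨∂ᵢq, aᵢ P⟩ + ⟨q, f P⟩ - ⟨q, g P⟩_S`. -/
noncomputable def pairAdjoint (gr : ν → V →L[ℝ] H) (vl : V →L[ℝ] H) (tc : V →L[ℝ] S)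
    (aX : V →L[ℝ] (ν → H)) (fX : V →L[ℝ] H) (gX : V →L[ℝ] S) (q : V) : V →L[ℝ] ℝ :=
  -(∑ i, (innerSL ℝ (gr i q)).comp ((ContinuousLinearMap.proj i).comp aX))
    + (innerSL ℝ (vl q)).comp fX - (innerSL ℝ (tc q)).comp gX

variable {gr : ν → V →L[ℝ] H} {vl : V →L[ℝ] H} {tc : V →L[ℝ] S}

theorem pairForm_apply (a : ν → H) (f : H) (g : S) (P : V) :
    pairForm gr vl tc a f g P = -(∑ i, ⟪a i, gr i P⟫_ℝ) + ⟪f, vl P⟫_ℝ - ⟪g, tc P⟫_ℝ := by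
  simp [pairForm, sum_apply]

theorem pairForm_add (a a' : ν → H) (f f' : H) (g g' : S) :
    pairForm gr vl tc (a + a') (f + f') (g + g')
      = pairForm gr vl tc a f g + pairForm gr vl tc a' f' g' := by
  ext P
  simp only [pairForm_apply, add_apply, Pi.add_apply, inner_add_left, Finset.sum_add_distrib]
  ring

theorem pairForm_smul (c : ℝ) (a : ν → H) (f : H) (g : S) :
    pairForm gr vl tc (c • a) (c • f) (c • g) = c • pairForm gr vl tc a f g := by
  ext P
  simp only [pairForm_apply, smul_apply, Pi.smul_apply, real_inner_smul_left, ← Finset.mul_sum,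
    smul_eq_mul]
  ring

/-- Green's formula in weak form; it makes the terms in `F_X` and `N_X` cancel in the first
variation. -/
theorem pairAdjoint_apply (aX : V →L[ℝ] (ν → H)) (fX : V →L[ℝ] H) (gX : V →L[ℝ] S) (q P : V) :
    pairAdjoint gr vl tc aX fX gX q P = pairForm gr vl tc (aX P) (fX P) (gX P) q := by
  rw [pairForm_apply]
  simp [pairAdjoint, sum_apply, real_inner_comm]

/-- The weak form of a linear pair, as a linear function of the state. -/
noncomputable def linearForm (gr : ν → V →L[ℝ] H) (vl : V →L[ℝ] H) (tc : V →L[ℝ] S)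
    (aX : V →L[ℝ] (ν → H)) (fX : V →L[ℝ] H) (gX : V →L[ℝ] S) : V →ₗ[ℝ] (V →L[ℝ] ℝ) where
  toFun P := pairForm gr vl tc (aX P) (fX P) (gX P)
  map_add' P R := by simp only [map_add, pairForm_add]
  map_smul' c P := by simp only [map_smul, pairForm_smul, RingHom.id_apply]

theorem linearForm_apply (aX : V →L[ℝ] (ν → H)) (fX : V →L[ℝ] H) (gX : V →L[ℝ] S) (P : V) :
    linearForm gr vl tc aX fX gX P = pairForm gr vl tc (aX P) (fX P) (gX P) := rfl

/-- Separates the homogeneous variation system from the forcing by the controls. -/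
theorem pairForm_linear_add (aX : V →L[ℝ] (ν → H)) (fX : V →L[ℝ] H) (gX : V →L[ℝ] S) (P : V)
    (f : H) (g : S) :
    pairForm gr vl tc (aX P) (fX P + f) (gX P + g)
      = linearForm gr vl tc aX fX gX P + pairForm gr vl tc 0 f g := by
  rw [linearForm_apply, ← pairForm_add, add_zero]

theorem pairForm_zero_smul (c : ℝ) (f : H) (g : S) :
    pairForm gr vl tc 0 (c • f) (c • g) = c • pairForm gr vl tc 0 f g := by
  rw [← pairForm_smul, smul_zero]

variable {t₀ tf : ℝ} [CompleteSpace H] [CompleteSpace S] [CompleteSpace E] [CompleteSpace F]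

/-- Pairing the first order backward equation with the variation dynamics: the feedback terms
cancel, and only the quadratic form in `Q_U` is left. -/
theorem first_variation_eq (ht : t₀ < tf)
    {aX : ℝ → V →L[ℝ] (ν → H)} {fX : ℝ → V →L[ℝ] H} {gX : ℝ → V →L[ℝ] S}
    {FU : ℝ → E →L[ℝ] H} {NU : ℝ → F →L[ℝ] S} {LX : ℝ → H} {Ld : ℝ → E} {Lb : ℝ → F} {φX : H}
    {invd : ℝ → E →L[ℝ] E} {invb : ℝ → F →L[ℝ] F} {QdX : ℝ → V →L[ℝ] E} {QbX : ℝ → V →L[ℝ] F}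
    {VX δX : ℝ → H × V} {Qd vd : ℝ → E} {Qb vb : ℝ → F}
    (hLX : MemLp LX 2 (timeMeasure t₀ tf)) (hLd : MemLp Ld 2 (timeMeasure t₀ tf))
    (hLb : MemLp Lb 2 (timeMeasure t₀ tf))
    (hsd : ∀ t ∈ Icc t₀ tf, ∀ u v, ⟪invd t u, v⟫_ℝ = ⟪u, invd t v⟫_ℝ)
    (hsb : ∀ t ∈ Icc t₀ tf, ∀ u v, ⟪invb t u, v⟫_ℝ = ⟪u, invb t v⟫_ℝ)
    (hQd : ∀ t, Qd t = Ld t + (FU t).adjoint (VX t).1)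
    (hQb : ∀ t, Qb t = Lb t - (NU t).adjoint (tc (VX t).2))
    (hvd : ∀ t, vd t = -invd t (Qd t) - invd t (QdX t (δX t).2))
    (hvb : ∀ t, vb t = -invb t (Qb t) - invb t (QbX t (δX t).2))
    (hvd2 : MemLp vd 2 (timeMeasure t₀ tf)) (hvb2 : MemLp vb 2 (timeMeasure t₀ tf))
    (hVX : HasTrajDeriv vl t₀ tf VX (fun t => -((innerSL ℝ (LX t)).comp vl
      + pairAdjoint gr vl tc (aX t) (fX t) (gX t) (VX t).2
      - (innerSL ℝ (invd t (Qd t))).comp (QdX t) - (innerSL ℝ (invb t (Qb t))).comp (QbX t))))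
    (hVXf : (VX tf).1 = φX)
    (hδX : HasTrajDeriv vl t₀ tf δX (fun t => pairForm gr vl tc (aX t (δX t).2)
      (fX t (δX t).2 + FU t (vd t)) (gX t (δX t).2 + NU t (vb t))))
    (hδ0 : (δX t₀).1 = 0) :
    ⟪φX, (δX tf).1⟫_ℝ
        + ∫ t in t₀..tf, (⟪LX t, (δX t).1⟫_ℝ + ⟪Ld t, vd t⟫_ℝ + ⟪Lb t, vb t⟫_ℝ)
      = -∫ t in t₀..tf, (⟪Qd t, invd t (Qd t)⟫_ℝ + ⟪Qb t, invb t (Qb t)⟫_ℝ) := by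
  have hparts := hVX.inner_sub_inner ht hδX
  rw [hVXf, hδ0, inner_zero_right, sub_zero] at hparts
  have hi1 := intervalIntegrable_inner ht.le hLX hδX.isPath.memLp_fst
  have hi2 := intervalIntegrable_inner ht.le hLd hvd2
  have hi3 := intervalIntegrable_inner ht.le hLb hvb2
  have hi4 := (intervalIntegrable_iff_integrableOn_Icc_of_le ht.le).2
    ((integrable_clm_apply hVX.memLp hδX.isPath.memLp).add
      (integrable_clm_apply hδX.memLp hVX.isPath.memLp))
  rw [hparts, ← intervalIntegral.integral_neg]
  refine (intervalIntegral.integral_add hi4 ((hi1.add hi2).add hi3)).symm.trans ?_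
  refine intervalIntegral.integral_congr_ae ?_
  rw [uIoc_of_le ht.le, ← ae_restrict_iff' measurableSet_Ioc]
  have hT : ∀ᵐ t ∂timeMeasure t₀ tf, t ∈ Icc t₀ tf := ae_restrict_mem measurableSet_Icc
  refine ae_restrict_of_ae_restrict_of_subset (t := Icc t₀ tf) Ioc_subset_Icc_self ?_
  change ∀ᵐ t ∂timeMeasure t₀ tf, _
  filter_upwards [hT, hVX.isPath.val_eq, hδX.isPath.val_eq] with t htT hv hx
  -- The forcing tested with `V_X` and the control gradient of `L` combine into `Q_U` paired with
  -- the update.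
  have hd : ⟪FU t (vd t), vl (VX t).2⟫_ℝ + ⟪Ld t, vd t⟫_ℝ = ⟪Qd t, vd t⟫_ℝ := by
    rw [hQd, inner_add_left, ContinuousLinearMap.adjoint_inner_left, hv, real_inner_comm (VX t).1]
    ring
  have hb : -⟪NU t (vb t), tc (VX t).2⟫_ℝ + ⟪Lb t, vb t⟫_ℝ = ⟪Qb t, vb t⟫_ℝ := by
    rw [hQb, inner_sub_left, ContinuousLinearMap.adjoint_inner_left,
      real_inner_comm (tc (VX t).2)]
    ring
  -- Symmetry of the inverse brings the feedback term to the form in which the equation for `V_X`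
  -- contains it with the opposite sign.
  have ed : ⟪Qd t, vd t⟫_ℝ = -⟪Qd t, invd t (Qd t)⟫_ℝ
      - ⟪invd t (Qd t), QdX t (δX t).2⟫_ℝ := by
    rw [hvd, inner_sub_right, inner_neg_right, hsd t htT]
  have eb : ⟪Qb t, vb t⟫_ℝ = -⟪Qb t, invb t (Qb t)⟫_ℝ
      - ⟪invb t (Qb t), QbX t (δX t).2⟫_ℝ := by
    rw [hvb, inner_sub_right, inner_neg_right, hsb t htT]
  simp only [Pi.add_apply, neg_apply, add_apply, sub_apply, ContinuousLinearMap.comp_apply,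
    innerSL_apply_apply, pairAdjoint_apply, pairForm_apply, inner_add_left, hx]
  linarith

/-- The change of the cost along the update agrees with the quadratic form in `Q_U` up to second
order. -/
theorem cost_change_isBigO (ht : t₀ < tf)
    {rhs : ℝ → V → E → F → (V →L[ℝ] ℝ)} {L : ℝ → H → E → F → ℝ} {φ : H → ℝ}
    {aX : ℝ → V →L[ℝ] (ν → H)} {fX : ℝ → V →L[ℝ] H} {gX : ℝ → V →L[ℝ] S}
    {FU : ℝ → E →L[ℝ] H} {NU : ℝ → F →L[ℝ] S} {LX : ℝ → H} {Ld : ℝ → E} {Lb : ℝ → F} {φX : H}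
    {invd : ℝ → E →L[ℝ] E} {invb : ℝ → F →L[ℝ] F} {QdX : ℝ → V →L[ℝ] E} {QbX : ℝ → V →L[ℝ] F}
    {VX δX : ℝ → H × V} {Qd ud vd : ℝ → E} {Qb ub vb : ℝ → F}
    {X₀ : H} {𝒳 : (ℝ → E) → (ℝ → F) → ℝ → H × V}
    (h𝒳 : ∀ (ud : ℝ → E) (ub : ℝ → F), MemLp ud 2 (timeMeasure t₀ tf) →
      MemLp ub 2 (timeMeasure t₀ tf) →
      HasTrajDeriv vl t₀ tf (𝒳 ud ub) (fun t => rhs t (𝒳 ud ub t).2 (ud t) (ub t)) ∧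
        (𝒳 ud ub t₀).1 = X₀)
    (hud : MemLp ud 2 (timeMeasure t₀ tf)) (hub : MemLp ub 2 (timeMeasure t₀ tf))
    (hcont : ∀ ε > 0, ∃ δ > 0, ∀ (ud' : ℝ → E) (ub' : ℝ → F),
      MemLp ud' 2 (timeMeasure t₀ tf) → MemLp ub' 2 (timeMeasure t₀ tf) →
      eLpNorm (ud' - ud) 2 (timeMeasure t₀ tf) < ENNReal.ofReal δ →
      eLpNorm (ub' - ub) 2 (timeMeasure t₀ tf) < ENNReal.ofReal δ →
      trajNorm t₀ tf (𝒳 ud' ub' - 𝒳 ud ub) < ε)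
    (hstab : ∃ K : ℝ, ∀ (ℓ : ℝ → (V →L[ℝ] ℝ)) (y : ℝ → H × V), MemLp ℓ 2 (timeMeasure t₀ tf) →
      HasTrajDeriv vl t₀ tf y (fun t =>
        pairForm gr vl tc (aX t (y t).2) (fX t (y t).2) (gX t (y t).2) + ℓ t) →
      trajNorm t₀ tf y ≤ K * (‖(y t₀).1‖ + (eLpNorm ℓ 2 (timeMeasure t₀ tf)).toReal))
    (hR : ∃ K : ℝ, ∃ r > 0, ∀ (γ : ℝ) (h : ℝ → H × V), |γ| ≤ r → IsTrajectory vl t₀ tf h →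
      trajNorm t₀ tf h ≤ r →
      MemLp (fun t => rhs t ((𝒳 ud ub t).2 + (h t).2) (ud t + γ • vd t) (ub t + γ • vb t)
        - rhs t (𝒳 ud ub t).2 (ud t) (ub t)
        - pairForm gr vl tc (aX t (h t).2) (fX t (h t).2 + FU t (γ • vd t))
            (gX t (h t).2 + NU t (γ • vb t))) 2 (timeMeasure t₀ tf) ∧
      eLpNorm (fun t => rhs t ((𝒳 ud ub t).2 + (h t).2) (ud t + γ • vd t) (ub t + γ • vb t)
        - rhs t (𝒳 ud ub t).2 (ud t) (ub t)
        - pairForm gr vl tc (aX t (h t).2) (fX t (h t).2 + FU t (γ • vd t))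
            (gX t (h t).2 + NU t (γ • vb t))) 2 (timeMeasure t₀ tf)
        ≤ ENNReal.ofReal (K * (trajNorm t₀ tf h + |γ|) ^ 2))
    (hL : ∃ K : ℝ, ∃ r > 0, ∀ (γ : ℝ) (h : ℝ → H × V), |γ| ≤ r → IsTrajectory vl t₀ tf h →
      trajNorm t₀ tf h ≤ r →
      IntegrableOn (fun t => L t ((𝒳 ud ub t).1 + (h t).1) (ud t + γ • vd t) (ub t + γ • vb t))
        (Icc t₀ tf) ∧
      |∫ t in t₀..tf, (L t ((𝒳 ud ub t).1 + (h t).1) (ud t + γ • vd t) (ub t + γ • vb t)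
          - L t (𝒳 ud ub t).1 (ud t) (ub t)
          - (⟪LX t, (h t).1⟫_ℝ + ⟪Ld t, γ • vd t⟫_ℝ + ⟪Lb t, γ • vb t⟫_ℝ))|
        ≤ K * (trajNorm t₀ tf h + |γ|) ^ 2)
    (hφ : ∃ K : ℝ, ∃ r > 0, ∀ h : H, ‖h‖ ≤ r →
      |φ ((𝒳 ud ub tf).1 + h) - φ (𝒳 ud ub tf).1 - ⟪φX, h⟫_ℝ| ≤ K * ‖h‖ ^ 2)
    (hLX : MemLp LX 2 (timeMeasure t₀ tf)) (hLd : MemLp Ld 2 (timeMeasure t₀ tf))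
    (hLb : MemLp Lb 2 (timeMeasure t₀ tf))
    (hsd : ∀ t ∈ Icc t₀ tf, ∀ u v, ⟪invd t u, v⟫_ℝ = ⟪u, invd t v⟫_ℝ)
    (hsb : ∀ t ∈ Icc t₀ tf, ∀ u v, ⟪invb t u, v⟫_ℝ = ⟪u, invb t v⟫_ℝ)
    (hQd : ∀ t, Qd t = Ld t + (FU t).adjoint (VX t).1)
    (hQb : ∀ t, Qb t = Lb t - (NU t).adjoint (tc (VX t).2))
    (hvd : ∀ t, vd t = -invd t (Qd t) - invd t (QdX t (δX t).2))
    (hvb : ∀ t, vb t = -invb t (Qb t) - invb t (QbX t (δX t).2))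
    (hvd2 : MemLp vd 2 (timeMeasure t₀ tf)) (hvb2 : MemLp vb 2 (timeMeasure t₀ tf))
    (hVX : HasTrajDeriv vl t₀ tf VX (fun t => -((innerSL ℝ (LX t)).comp vl
      + pairAdjoint gr vl tc (aX t) (fX t) (gX t) (VX t).2
      - (innerSL ℝ (invd t (Qd t))).comp (QdX t) - (innerSL ℝ (invb t (Qb t))).comp (QbX t))))
    (hVXf : (VX tf).1 = φX)
    (hδX : HasTrajDeriv vl t₀ tf δX (fun t => pairForm gr vl tc (aX t (δX t).2)
      (fX t (δX t).2 + FU t (vd t)) (gX t (δX t).2 + NU t (vb t))))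
    (hδ0 : (δX t₀).1 = 0) :
    (fun γ : ℝ => (φ (𝒳 (ud + γ • vd) (ub + γ • vb) tf).1
        + ∫ t in t₀..tf, L t (𝒳 (ud + γ • vd) (ub + γ • vb) t).1 (ud t + γ • vd t)
          (ub t + γ • vb t))
      - (φ (𝒳 ud ub tf).1 + ∫ t in t₀..tf, L t (𝒳 ud ub t).1 (ud t) (ub t))
      + γ * ∫ t in t₀..tf, (⟪Qd t, invd t (Qd t)⟫_ℝ + ⟪Qb t, invb t (Qb t)⟫_ℝ))
      =O[𝓝 0] (fun γ => γ ^ 2) := by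
  have hudγ : ∀ γ : ℝ, MemLp (ud + γ • vd) 2 (timeMeasure t₀ tf) := fun γ =>
    hud.add (hvd2.const_smul γ)
  have hubγ : ∀ γ : ℝ, MemLp (ub + γ • vb) 2 (timeMeasure t₀ tf) := fun γ =>
    hub.add (hvb2.const_smul γ)
  have hsol := h𝒳 _ _ hud hub
  have hsolγ := fun γ : ℝ => h𝒳 _ _ (hudγ γ) (hubγ γ)
  have hexp : ∃ K, 0 ≤ K ∧ ∀ᶠ γ in 𝓝 (0 : ℝ),
      trajNorm t₀ tf (𝒳 (ud + γ • vd) (ub + γ • vb) - 𝒳 ud ub) ≤ K * |γ| ∧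
      trajNorm t₀ tf (𝒳 (ud + γ • vd) (ub + γ • vb) - 𝒳 ud ub - γ • δX) ≤ K * γ ^ 2 := by
    refine trajNorm_linearisation_le (𝓐 := fun t => linearForm gr vl tc (aX t) (fX t) (gX t))
      (ℓδ := fun t => pairForm gr vl tc 0 (FU t (vd t)) (NU t (vb t))) ht hstab ?_ hδ0 hsol.1
      (fun γ => (hsolγ γ).1) (fun γ => (hsolγ γ).2.trans hsol.2.symm) ?_ ?_
    · simp_rw [pairForm_linear_add] at hδX
      exact hδX
    · intro ε hε
      obtain ⟨δ, hδ, hst⟩ := hcont ε hε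
      filter_upwards [eventually_eLpNorm_smul_lt hvd2 hδ, eventually_eLpNorm_smul_lt hvb2 hδ]
        with γ h1 h2
      refine hst _ _ (hudγ γ) (hubγ γ) ?_ ?_
      · rwa [add_sub_cancel_left]
      · rwa [add_sub_cancel_left]
    · obtain ⟨K, r, hr, hR⟩ := hR
      refine ⟨K, r, hr, fun γ hγ hp => ?_⟩
      have h := hR γ _ hγ ((hsolγ γ).1.isPath.sub hsol.1.isPath) hp
      simp_rw [pairForm_linear_add, map_smul, pairForm_zero_smul, Pi.sub_apply, Prod.snd_sub,
        add_sub_cancel] at h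
      exact h
  obtain ⟨K, hK, hest⟩ := hexp
  have h := cost_expansion ht hLX hLd hLb hsol.1.isPath hδX.isPath hvd2 hvb2 hL hφ
    (fun γ => (hsolγ γ).1.isPath) hK hest
  rw [first_variation_eq ht hLX hLd hLb hsd hsb hQd hQb hvd hvb hvd2 hvb2 hVX hVXf hδX hδ0] at h
  simpa only [mul_neg, sub_neg_eq_add] using h

end WeakForms

/-! ### Descent from the quadratic form, and the operator `L_UU⁻¹`. -/

section Descent

/-- First order consequences of an expansion `J γ = J 0 - γ q + O(γ²)`. -/
theorem hasDerivAt_of_isBigO_sq {J : ℝ → ℝ} {q : ℝ}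
    (h : (fun γ => J γ - J 0 + γ * q) =O[𝓝 0] (fun γ => γ ^ 2)) : HasDerivAt J (-q) 0 := by
  rw [hasDerivAt_iff_isLittleO]
  have h1 : (fun γ : ℝ => γ ^ 2) =o[𝓝 0] (fun γ => γ) := by
    simpa using Asymptotics.isLittleO_pow_pow (𝕜 := ℝ) (show 1 < 2 by norm_num)
  refine (h.trans_isLittleO h1).congr (fun γ => ?_) (fun γ => ?_)
  · simp
  · simp

theorem eventually_lt_of_isBigO_sq {J : ℝ → ℝ} {q : ℝ} (hq : 0 < q)
    (h : (fun γ => J γ - J 0 + γ * q) =O[𝓝 0] (fun γ => γ ^ 2)) :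
    ∀ᶠ γ in 𝓝[>] (0 : ℝ), J γ < J 0 := by
  have hd := (hasDerivAt_of_isBigO_sq h).hasDerivWithinAt (s := Ioi 0)
  rw [hasDerivWithinAt_iff_tendsto_slope' (by simp)] at hd
  filter_upwards [hd.eventually (gt_mem_nhds (neg_neg_of_pos hq)), self_mem_nhdsWithin] with γ h1 h2
  rw [slope_def_field, sub_zero, div_neg_iff] at h1
  have h2' : 0 < γ := h2
  rcases h1 with h1 | h1 <;> linarith [h1.1, h1.2]

variable {E F : Type*} [NormedAddCommGroup E] [InnerProductSpace ℝ E] [CompleteSpace E]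
  [NormedAddCommGroup F] [InnerProductSpace ℝ F] [CompleteSpace F] {t₀ tf : ℝ}

/-- The operator `L_UU⁻¹` on the space of stacked controls. -/
theorem exists_blockDiag_inverse {Ad : ℝ → E →L[ℝ] E} {Ab : ℝ → F →L[ℝ] F}
    (hmd : ∀ u, AEStronglyMeasurable (fun t => Ad t u) (timeMeasure t₀ tf))
    (hmb : ∀ u, AEStronglyMeasurable (fun t => Ab t u) (timeMeasure t₀ tf))
    (hsd : ∀ t ∈ Icc t₀ tf, ∀ u v, ⟪Ad t u, v⟫_ℝ = ⟪u, Ad t v⟫_ℝ)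
    (hsb : ∀ t ∈ Icc t₀ tf, ∀ u v, ⟪Ab t u, v⟫_ℝ = ⟪u, Ab t v⟫_ℝ)
    (hbd : ∃ K, ∀ t ∈ Icc t₀ tf, ‖Ad t‖ ≤ K) (hbb : ∃ K, ∀ t ∈ Icc t₀ tf, ‖Ab t‖ ≤ K)
    (hpd : ∃ m > 0, ∀ t ∈ Icc t₀ tf, ∀ u, m * ‖u‖ ^ 2 ≤ ⟪u, Ad t u⟫_ℝ)
    (hpb : ∃ m > 0, ∀ t ∈ Icc t₀ tf, ∀ u, m * ‖u‖ ^ 2 ≤ ⟪u, Ab t u⟫_ℝ) :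
    ∃ (M : Lp (WithLp 2 (E × F)) 2 (timeMeasure t₀ tf)
        →L[ℝ] Lp (WithLp 2 (E × F)) 2 (timeMeasure t₀ tf))
      (m : ℝ → WithLp 2 (E × F) →L[ℝ] WithLp 2 (E × F)),
      (∀ u : Lp (WithLp 2 (E × F)) 2 (timeMeasure t₀ tf),
        ∀ᵐ t ∂timeMeasure t₀ tf, M u t = m t (u t)) ∧
      (∀ t ∈ Icc t₀ tf, ∀ (u : E) (b : F),
        m t (WithLp.toLp 2 (Ad t u, Ab t b)) = WithLp.toLp 2 (u, b)) ∧
      (∀ t ∈ Icc t₀ tf, ∀ u v, ⟪m t u, v⟫_ℝ = ⟪u, m t v⟫_ℝ) ∧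
      (∃ c > 0, ∀ t ∈ Icc t₀ tf, ∀ u, c * ‖u‖ ^ 2 ≤ ⟪u, m t u⟫_ℝ) := by
  obtain ⟨Kd, hKd⟩ := hbd
  obtain ⟨Kb, hKb⟩ := hbb
  obtain ⟨cd, hcd, hpd⟩ := hpd
  obtain ⟨cb, hcb, hpb⟩ := hpb
  -- The `1` guarantees a positive bound, since `c / K ^ 2` becomes the coercivity constant.
  set K := max (max Kd Kb) 1
  have hK : 0 < K := lt_max_of_lt_right one_pos
  set A : ℝ → WithLp 2 (E × F) →L[ℝ] WithLp 2 (E × F) := fun t => blockDiag (Ad t) (Ab t) with hA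
  set c := min cd cb
  have hc : 0 < c := lt_min hcd hcb
  have hnorm : ∀ t ∈ Icc t₀ tf, ‖A t‖ ≤ K := fun t ht => norm_blockDiag_le
    ((hKd t ht).trans ((le_max_left _ _).trans (le_max_left _ _)))
    ((hKb t ht).trans ((le_max_right _ _).trans (le_max_left _ _)))
  have hcoer : ∀ t ∈ Icc t₀ tf, ∀ u, c * ‖u‖ ^ 2 ≤ ⟪u, A t u⟫_ℝ := fun t ht u =>
    blockDiag_coercive (hpd t ht) (hpb t ht) u
  have hunit : ∀ t ∈ Icc t₀ tf, IsUnit (A t) := fun t ht => isUnit_of_coercive hc (hcoer t ht)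
  have hmeas : ∀ u, AEStronglyMeasurable (fun t => A t u) (timeMeasure t₀ tf) := fun u =>
    (WithLp.prod_continuous_toLp 2 E F).comp_aestronglyMeasurable
      ((hmd u.fst).prodMk (hmb u.snd))
  have hT : ∀ᵐ t ∂timeMeasure t₀ tf, t ∈ Icc t₀ tf := ae_restrict_mem measurableSet_Icc
  obtain ⟨M, hM⟩ := exists_Lp_clm (B := fun t => Ring.inverse (A t)) (c := c⁻¹)
    (aestronglyMeasurable_inverse_apply hc (hT.mono hnorm) (hT.mono hcoer) hmeas)
    (hT.mono fun t ht => norm_inverse_le_of_coercive hc (hcoer t ht))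
  refine ⟨M, fun t => Ring.inverse (A t), hM, fun t ht u b => ?_, fun t ht => ?_,
    c / K ^ 2, by positivity, fun t ht => inverse_coercive hc hK (hnorm t ht) (hcoer t ht)⟩
  · exact inverse_apply_of_isUnit (hunit t ht) (WithLp.toLp 2 (u, b))
  · exact inner_inverse_of_symm (hunit t ht) (blockDiag_symm (hsd t ht) (hsb t ht))

/-- The operator `L_UU⁻¹` turns an expansion of the cost with the quadratic form in `Q_U` into
first order descent. -/
theorem exists_descent_operator (ht : t₀ < tf) {Ad : ℝ → E →L[ℝ] E} {Ab : ℝ → F →L[ℝ] F}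
    (hmd : ∀ u, AEStronglyMeasurable (fun t => Ad t u) (timeMeasure t₀ tf))
    (hmb : ∀ u, AEStronglyMeasurable (fun t => Ab t u) (timeMeasure t₀ tf))
    (hsd : ∀ t ∈ Icc t₀ tf, ∀ u v, ⟪Ad t u, v⟫_ℝ = ⟪u, Ad t v⟫_ℝ)
    (hsb : ∀ t ∈ Icc t₀ tf, ∀ u v, ⟪Ab t u, v⟫_ℝ = ⟪u, Ab t v⟫_ℝ)
    (hbd : ∃ K, ∀ t ∈ Icc t₀ tf, ‖Ad t‖ ≤ K) (hbb : ∃ K, ∀ t ∈ Icc t₀ tf, ‖Ab t‖ ≤ K)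
    (hpd : ∃ m > 0, ∀ t ∈ Icc t₀ tf, ∀ u, m * ‖u‖ ^ 2 ≤ ⟪u, Ad t u⟫_ℝ)
    (hpb : ∃ m > 0, ∀ t ∈ Icc t₀ tf, ∀ u, m * ‖u‖ ^ 2 ≤ ⟪u, Ab t u⟫_ℝ)
    {Qd : ℝ → E} {Qb : ℝ → F} {Q : ℝ → WithLp 2 (E × F)}
    (hQe : ∀ t, Q t = WithLp.toLp 2 (Qd t, Qb t)) (hQ : MemLp Q 2 (timeMeasure t₀ tf))
    {J : ℝ → ℝ}
    (hJ : (fun γ => J γ - J 0 + γ * ∫ t in t₀..tf, (⟪Qd t, Ring.inverse (Ad t) (Qd t)⟫_ℝ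
      + ⟪Qb t, Ring.inverse (Ab t) (Qb t)⟫_ℝ)) =O[𝓝 0] (fun γ => γ ^ 2)) :
    ∃ (M : Lp (WithLp 2 (E × F)) 2 (timeMeasure t₀ tf)
        →L[ℝ] Lp (WithLp 2 (E × F)) 2 (timeMeasure t₀ tf))
      (m : ℝ → WithLp 2 (E × F) →L[ℝ] WithLp 2 (E × F)),
      (∀ u : Lp (WithLp 2 (E × F)) 2 (timeMeasure t₀ tf),
        ∀ᵐ t ∂timeMeasure t₀ tf, M u t = m t (u t)) ∧
      (∀ t ∈ Icc t₀ tf, ∀ (u : E) (b : F),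
        m t (WithLp.toLp 2 (Ad t u, Ab t b)) = WithLp.toLp 2 (u, b)) ∧
      (∀ t ∈ Icc t₀ tf, ∀ u v, ⟪m t u, v⟫_ℝ = ⟪u, m t v⟫_ℝ) ∧
      (∃ c > 0, ∀ t ∈ Icc t₀ tf, ∀ u, c * ‖u‖ ^ 2 ≤ ⟪u, m t u⟫_ℝ) ∧
      (∃ ρ : ℝ → ℝ, ρ =O[𝓝 0] (fun γ => γ ^ 2) ∧ ∀ γ : ℝ,
        HasDerivAt (fun i : ℝ => J (i * γ)) (-γ * ⟪hQ.toLp Q, M (hQ.toLp Q)⟫_ℝ + ρ γ) 0) ∧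
      (fun γ => J γ - J 0 + γ * ⟪hQ.toLp Q, M (hQ.toLp Q)⟫_ℝ) =O[𝓝 0] (fun γ => γ ^ 2) ∧
      (hQ.toLp Q ≠ 0 → ∀ᶠ γ in 𝓝[>] (0 : ℝ), J γ < J 0) := by
  obtain ⟨M, m, hM, hmi, hms, c, hc, hmc⟩ :=
    exists_blockDiag_inverse hmd hmb hsd hsb hbd hbb hpd hpb
  obtain ⟨cd, hcd, hpd⟩ := hpd
  obtain ⟨cb, hcb, hpb⟩ := hpb
  have hT : ∀ᵐ t ∂timeMeasure t₀ tf, t ∈ Icc t₀ tf := ae_restrict_mem measurableSet_Icc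
  have hq : ⟪hQ.toLp Q, M (hQ.toLp Q)⟫_ℝ = ∫ t in t₀..tf,
      (⟪Qd t, Ring.inverse (Ad t) (Qd t)⟫_ℝ + ⟪Qb t, Ring.inverse (Ab t) (Qb t)⟫_ℝ) := by
    rw [L2.inner_def, intervalIntegral.integral_of_le ht.le, ← integral_Icc_eq_integral_Ioc]
    refine integral_congr_ae ?_
    filter_upwards [hT, hM (hQ.toLp Q), hQ.coeFn_toLp] with t htT h1 h2
    -- Applied at the preimage of `Q t` under `L_UU`, the inverse relation evaluates `m t (Q t)`
    -- componentwise.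
    have h3 := hmi t htT (Ring.inverse (Ad t) (Qd t)) (Ring.inverse (Ab t) (Qb t))
    rw [apply_inverse_of_isUnit (isUnit_of_coercive hcd (hpd t htT)),
      apply_inverse_of_isUnit (isUnit_of_coercive hcb (hpb t htT)), ← hQe] at h3
    rw [h1, h2, h3, hQe, WithLp.prod_inner_apply]
  rw [← hq] at hJ
  -- At the current iterate the chain rule gives exactly `-γ q`, so the remainder `ρ` can be taken
  -- to be zero.
  refine ⟨M, m, hM, hmi, hms, ⟨c, hc, hmc⟩, ⟨0, Asymptotics.isBigO_zero _ _, fun γ => ?_⟩, hJ,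
    fun hne => eventually_lt_of_isBigO_sq ?_ hJ⟩
  · have h1 := hasDerivAt_of_isBigO_sq hJ
    rw [← zero_mul γ] at h1
    have h2 := h1.comp (0 : ℝ) ((hasDerivAt_id (0 : ℝ)).mul_const γ)
    convert! h2 using 1
    simp [mul_comm]
  · have hpos : 0 < ‖hQ.toLp Q‖ := norm_pos_iff.2 hne
    refine (show 0 < c * ‖hQ.toLp Q‖ ^ 2 by positivity).trans_le ?_
    -- Pointwise coercivity of `m t` integrates to coercivity of `M`.
    rw [← real_inner_self_eq_norm_sq, L2.inner_def, L2.inner_def, ← integral_const_mul]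
    refine integral_mono_ae ((L2.integrable_inner _ _).const_mul c) (L2.integrable_inner _ _) ?_
    filter_upwards [hT, hM (hQ.toLp Q)] with t htT h1
    rw [h1, real_inner_self_eq_norm_sq]
    exact hmc t htT _

end Descent

end STDDP

/-! ### The theorem over the domain and its boundary. -/

set_option maxHeartbeats 4000000 in
set_option synthInstance.maxHeartbeats 400000 in
open STDDP in
theorem mainTheorem1 {d n k l : ℕ} (D Γ : Set (Euc d)) (hDo : IsOpen D) (hDc : IsConnected D)
    (hΓ : MeasurableSet Γ) (hΓS : Γ ⊆ frontier D)
    (t₀ tf : ℝ) (ht : t₀ < tf)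
    (sys : System D Γ n k l) (C : Cost D n k l) (hwp : sys.WellPosed t₀ tf) (X₀ : L2D D n)
    -- the control-to-state map
    (𝒳 : (ℝ → L2D D k) → (ℝ → L2S D l) → Path D Γ n)
    (h𝒳 : ∀ (ud : ℝ → L2D D k) (ub : ℝ → L2S D l), MemLp ud 2 (timeMeasure t₀ tf) →
      MemLp ub 2 (timeMeasure t₀ tf) → sys.IsSolution t₀ tf X₀ ud ub (𝒳 ud ub))
    -- the nominal controls, and the derivatives along the nominal trajectory
    (Ud : ℝ → L2D D k) (Ub : ℝ → L2S D l)
    (hUd : MemLp Ud 2 (timeMeasure t₀ tf)) (hUb : MemLp Ub 2 (timeMeasure t₀ tf))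
    (A : Derivs D Γ n k l)
    (hAS : A.OfSystem sys t₀ tf (𝒳 Ud Ub) Ud Ub) (hAC : A.OfCost C t₀ tf (𝒳 Ud Ub) Ud Ub)
    (hAr : A.Regular t₀ tf) (hAwp : A.VariationWellPosed t₀ tf)
    -- the STDDP sweep
    (VX δX : Path D Γ n) (VXX : OpPath D Γ n)
    (hVX : A.BackwardFirst t₀ tf VX VXX) (hVXX : A.BackwardSecond t₀ tf VXX)
    (hδX : A.Variation t₀ tf VX VXX δX)
    (hδUd : MemLp (A.δUd VX VXX δX) 2 (timeMeasure t₀ tf))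
    (hδUb : MemLp (A.δUb VX VXX δX) 2 (timeMeasure t₀ tf))
    (hQ : MemLp (A.QU VX) 2 (timeMeasure t₀ tf))
    -- the remainders of the expansions around the nominal trajectory
    (hES : A.SystemExpansion sys t₀ tf (𝒳 Ud Ub) Ud (A.δUd VX VXX δX) Ub (A.δUb VX VXX δX))
    (hEC : A.CostExpansion C t₀ tf (𝒳 Ud Ub) Ud (A.δUd VX VXX δX) Ub (A.δUb VX VXX δX)) :
    let J : ℝ → ℝ := fun γ =>
      C.total t₀ tf (𝒳 (Ud + γ • A.δUd VX VXX δX) (Ub + γ • A.δUb VX VXX δX))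
        (Ud + γ • A.δUd VX VXX δX) (Ub + γ • A.δUb VX VXX δX)
    ∃ (M : Lp (Ctrl D k l) 2 (timeMeasure t₀ tf) →L[ℝ] Lp (Ctrl D k l) 2 (timeMeasure t₀ tf))
      (m : ℝ → Ctrl D k l →L[ℝ] Ctrl D k l),
      -- `M` acts at each time by the operator `m t`, which is the inverse of `L_UU`
      (∀ u : Lp (Ctrl D k l) 2 (timeMeasure t₀ tf),
        ∀ᵐ t ∂timeMeasure t₀ tf, M u t = m t (u t)) ∧
      (∀ t ∈ Set.Icc t₀ tf, ∀ (u : L2D D k) (b : L2S D l),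
        m t (WithLp.toLp 2 (A.LUdUd t u, A.LUbUb t b)) = WithLp.toLp 2 (u, b)) ∧
      -- symmetric and (uniformly) positive definite for every `t`
      (∀ t ∈ Set.Icc t₀ tf, ∀ u v, ⟪m t u, v⟫_ℝ = ⟪u, m t v⟫_ℝ) ∧
      (∃ c > 0, ∀ t ∈ Set.Icc t₀ tf, ∀ u, c * ‖u‖ ^ 2 ≤ ⟪u, m t u⟫_ℝ) ∧
      -- along `dU/di = γ δU`, the derivative of the cost with respect to the iteration index `i`
      (∃ ρ : ℝ → ℝ, ρ =O[𝓝 0] (fun γ => γ ^ 2) ∧ ∀ γ : ℝ,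
        HasDerivAt (fun i : ℝ => J (i * γ))
          (-γ * ⟪hQ.toLp (A.QU VX), M (hQ.toLp (A.QU VX))⟫_ℝ + ρ γ) 0) ∧
      -- the change of the cost over one iteration with step size `γ`
      (fun γ => J γ - J 0 + γ * ⟪hQ.toLp (A.QU VX), M (hQ.toLp (A.QU VX))⟫_ℝ)
        =O[𝓝 0] (fun γ => γ ^ 2) ∧
      -- first order descent
      (hQ.toLp (A.QU VX) ≠ 0 → ∀ᶠ γ in 𝓝[>] (0 : ℝ), J γ < J 0) := by
  have hsol := h𝒳 Ud Ub hUd hUb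
  -- The concrete and abstract notions of trajectory agree field by field with `ι = val`; these
  -- facts carry the hypotheses across.
  have htraj : ∀ {x : Path D Γ n}, IsPath t₀ tf x →
      IsTrajectory (val : fieldSpace D Γ n →L[ℝ] L2D D n) t₀ tf x := fun h => ⟨h.1, h.2, h.3⟩
  have hpath : ∀ {x : Path D Γ n},
      IsTrajectory (val : fieldSpace D Γ n →L[ℝ] L2D D n) t₀ tf x → IsPath t₀ tf x :=
    fun h => ⟨h.1, h.2, h.3⟩
  have hderiv : ∀ {x : Path D Γ n} {ℓ : ℝ → (fieldSpace D Γ n →L[ℝ] ℝ)},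
      HasWeakTimeDeriv t₀ tf x ℓ →
      HasTrajDeriv (val : fieldSpace D Γ n →L[ℝ] L2D D n) t₀ tf x ℓ :=
    fun h => ⟨htraj h.1, h.2, h.3⟩
  have hweak : ∀ {x : Path D Γ n} {ℓ : ℝ → (fieldSpace D Γ n →L[ℝ] ℝ)},
      HasTrajDeriv (val : fieldSpace D Γ n →L[ℝ] L2D D n) t₀ tf x ℓ →
      HasWeakTimeDeriv t₀ tf x ℓ :=
    fun h => ⟨hpath h.1, h.2, h.3⟩
  intro J
  have hsd : ∀ t ∈ Icc t₀ tf, ∀ u v, ⟪A.invd t u, v⟫_ℝ = ⟪u, A.invd t v⟫_ℝ := by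
    obtain ⟨c, hc, h⟩ := hAr.pos_d
    exact fun t ht => inner_inverse_of_symm (isUnit_of_coercive hc (h t ht)) (hAr.symm_d t ht)
  have hsb : ∀ t ∈ Icc t₀ tf, ∀ u v, ⟪A.invb t u, v⟫_ℝ = ⟪u, A.invb t v⟫_ℝ := by
    obtain ⟨c, hc, h⟩ := hAr.pos_b
    exact fun t ht => inner_inverse_of_symm (isUnit_of_coercive hc (h t ht)) (hAr.symm_b t ht)
  have hJ0 : J 0 = C.total t₀ tf (𝒳 Ud Ub) Ud Ub := by
    simp only [J, zero_smul, add_zero]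
  have hJ : (fun γ => J γ - J 0 + γ * ∫ t in t₀..tf, (⟪A.Qd VX t, A.invd t (A.Qd VX t)⟫_ℝ
      + ⟪A.Qb VX t, A.invb t (A.Qb VX t)⟫_ℝ)) =O[𝓝 0] (fun γ => γ ^ 2) := by
    rw [hJ0]
    refine cost_change_isBigO (V := fieldSpace D Γ n) (H := L2D D n) (S := L2S D n)
      (E := L2D D k) (F := L2S D l) (ν := Fin d) (gr := grad) (vl := val) (tc := tr)
      (rhs := sys.rhs) (L := C.running) (φ := C.terminal tf)
      (aX := A.aX) (fX := A.fX) (gX := A.gX) (FU := A.FU) (NU := A.NU) (LX := A.LX)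
      (Ld := A.LUd) (Lb := A.LUb) (φX := A.φX) (invd := A.invd) (invb := A.invb)
      (QdX := A.QdX VXX) (QbX := A.QbX VXX) (VX := VX) (δX := δX) (Qd := A.Qd VX)
      (Qb := A.Qb VX) (ud := Ud) (ub := Ub) (vd := A.δUd VX VXX δX) (vb := A.δUb VX VXX δX)
      (X₀ := X₀) (𝒳 := 𝒳) ht (fun ud ub h1 h2 => ⟨hderiv (h𝒳 ud ub h1 h2).1, (h𝒳 ud ub h1 h2).2⟩)
      hUd hUb ?_ ?_ ?_ ?_ hEC.2 hAr.memLp_LX hAr.memLp_LUd hAr.memLp_LUb hsd hsb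
      (fun _ => rfl) (fun _ => rfl) (fun _ => rfl) (fun _ => rfl) hδUd hδUb
      (hderiv hVX.1) hVX.2 (hderiv hδX.1) hδX.2
    · intro ε hε
      obtain ⟨δ, hδ, h⟩ := hwp.stability X₀ Ud Ub _ hUd hUb hsol ε hε
      -- All states start from `X₀`, so only the controls are perturbed.
      exact ⟨δ, hδ, fun ud' ub' h1 h2 h3 h4 => h X₀ ud' ub' _ h1 h2 (h𝒳 ud' ub' h1 h2)
        (by rwa [sub_self, norm_zero]) h3 h4⟩
    · obtain ⟨K, h⟩ := hAwp.stability
      exact ⟨K, fun ℓ y hℓ hy => h ℓ y hℓ (hweak hy)⟩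
    · obtain ⟨K, r, hr, h⟩ := hES
      exact ⟨K, r, hr, fun γ y hγ hy hp => h γ y hγ (hpath hy) hp⟩
    · obtain ⟨K, r, hr, h⟩ := hEC.1
      exact ⟨K, r, hr, fun γ y hγ hy hp => h γ y hγ (hpath hy) hp⟩
  exact exists_descent_operator (E := L2D D k) (F := L2S D l) ht hAr.meas_d hAr.meas_b hAr.symm_d
    hAr.symm_b hAr.bdd_d hAr.bdd_b hAr.pos_d hAr.pos_b (fun _ => rfl) hQ hJ
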